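/- Let $\mathbb D$ be the open unit disc and $\mathbb T$ the unit circle, and let $\mu=\delta_1+\delta_i$ on $\mathbb T$. Let $D(\mu)$ be the Dirichlet-type space of all holomorphic $f(z)=\sum_{n\ge 0}a_nz^n$ on $\mathbb D$ with $\int_{\mathbb D}|f'|^2P_\mu\,dA<\infty$, where $P_\mu(z)=\int_{\mathbb T}\frac{1-|z|^2}{|z-\zeta|^2}\,d\mu(\zeta)$ and $dA$ is Lebesgue area measure normalised by $A(\mathbb D)=1$, with the norm $$\|f\|_{D(\mu)}^2=\sum_{n\ge0}|a_n|^2+\int_{\mathbb D}|f'|^2P_\mu\,dA .$$ For a holomorphic row $B=(b_1,b_2)$ on $\mathbb D$ with $|b_1(z)|^2+|b_2(z)|^2\le 1$ for all $z\in\mathbb D$ (that is, $B$ in the Schur class $S(\mathbb C^2,\mathbb C)$), the de Branges–Rovnyak space $H(B)$ is the reproducing kernel Hilbert space on $\mathbb D$ with kernel $\frac{1-b_1(z)\overline{b_1(w)}-b_2(z)\overline{b_2(w)}}{1-z\overline w}$. Then there are real numbers $x,y,c,r,d$ whose decimal values, correctly rounded, are $$x\approx 2.32798295504488,\quad y\approx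 0.207814156136787,\quad c\approx 4.13925355,\quad r\approx 1.31972862,\quad d\approx 1.11084575$$ (the error is at most half a unit in the last digit shown) such that, with $$p_1(z)=cz+(-r+ri)z^2,\qquad p_2(z)=dz^2,\qquad q(z)=(z-\alpha_1)(z-\alpha_2),\quad \alpha_1=x+iy,\ \alpha_2=y+ix,$$ the polynomial $q$ has no zero in $\mathbb D$, the row $B=(b_1,b_2)$ with $b_j=p_j/q$ belongs to the Schur class, and $D(\mu)=H(B)$ as sets of functions with equal norms: $\|f\|_{D(\mu)}=\|f\|_{H(B)}$ for every $f$ in this space. -/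

import Mathlib

open scoped Complex.UnitDisc

namespace DirichletDBR

noncomputable section

/-- The function on the open unit disc `𝔻`, extended by `0` to the whole plane. Derivatives at
points of the (open) disc do not depend on the extension. -/
def extendZero {E : Type*} [Zero E] (f : 𝔻 → E) : ℂ → E :=
  Function.extend ((↑) : 𝔻 → ℂ) f 0

/-- Holomorphic functions on the unit disc, with values in a complex normed space. -/
def Holomorphic {E : Type*} [NormedAddCommGroup E] [NormedSpace ℂ E] (f : 𝔻 → E) : Prop :=
  DifferentiableOn ℂ (extendZero f) (Metric.ball 0 1)

/-- The `n`-th Taylor coefficient at the origin. -/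
def taylorCoeff (f : 𝔻 → ℂ) (n : ℕ) : ℂ :=
  iteratedDeriv n (extendZero f) 0 / (n.factorial : ℂ)

/-- The squared Hardy space norm `∑ |a_n|²` (it is `∞` when `f` is not in `H²`). -/
def hardyNormSq (f : 𝔻 → ℂ) : ENNReal :=
  ∑' n : ℕ, ‖taylorCoeff f n‖ₑ ^ 2

/-- The unit circle `𝕋`, with its Borel σ-algebra. -/
abbrev UnitCircle : Type := Metric.sphere (0 : ℂ) 1

/-- The Poisson integral of a measure on the unit circle. -/
def poissonIntegral (μ : MeasureTheory.Measure UnitCircle) (z : ℂ) : ℝ :=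
  ∫ ζ : UnitCircle, (1 - ‖z‖ ^ 2) / ‖z - (ζ : ℂ)‖ ^ 2 ∂μ

/-- Normalised Lebesgue area measure: the unit disc has measure one. -/
def areaMeasure : MeasureTheory.Measure ℂ :=
  (ENNReal.ofReal Real.pi)⁻¹ • MeasureTheory.volume

/-- The weighted Dirichlet integral `∫_𝔻 |f'|² P_μ dA`. -/
def dirichletIntegral (μ : MeasureTheory.Measure UnitCircle) (f : 𝔻 → ℂ) : ENNReal :=
  ∫⁻ z in Metric.ball (0 : ℂ) 1,
    ‖deriv (extendZero f) z‖ₑ ^ 2 * ENNReal.ofReal (poissonIntegral μ z) ∂areaMeasure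

/-- The Dirichlet-type space `D(μ)`, as a set of functions on the disc. -/
def dirichletSpace (μ : MeasureTheory.Measure UnitCircle) : Set (𝔻 → ℂ) :=
  {f | Holomorphic f ∧ dirichletIntegral μ f < ⊤}

/-- The squared norm of `D(μ)`: `‖f‖²_{H²} + ∫_𝔻 |f'|² P_μ dA`. -/
def dirichletNormSq (μ : MeasureTheory.Measure UnitCircle) (f : 𝔻 → ℂ) : ENNReal :=
  hardyNormSq f + dirichletIntegral μ f

section DeBrangesRovnyak

variable {U V : Type*} [NormedAddCommGroup U] [InnerProductSpace ℂ U] [CompleteSpace U]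
  [NormedAddCommGroup V] [InnerProductSpace ℂ V] [CompleteSpace V]

/-- The Schur class: contractive operator-valued holomorphic functions on the disc. -/
def SchurClass (B : 𝔻 → (U →L[ℂ] V)) : Prop :=
  Holomorphic B ∧ ∀ z, ‖B z‖ ≤ 1

/-- The kernel `K_B(z, w) = (I - B(z) B(w)^*) / (1 - z conj(w))`. -/
def dBRKernel (B : 𝔻 → (U →L[ℂ] V)) : Matrix 𝔻 𝔻 (V →L[ℂ] V) :=
  Matrix.of fun z w =>
    (1 - (z : ℂ) * (starRingEnd ℂ) (w : ℂ))⁻¹ •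
      (ContinuousLinearMap.id ℂ V - (B z) ∘L (ContinuousLinearMap.adjoint (B w)))

/-- The de Branges–Rovnyak space `H(B)`: the reproducing kernel Hilbert space of `V`-valued
functions on the disc whose kernel is `K_B`. -/
abbrev DeBrangesRovnyak (B : 𝔻 → (U →L[ℂ] V)) [Fact (dBRKernel B).PosSemidef] : Type _ :=
  RKHS.OfKernel (dBRKernel B)

end DeBrangesRovnyak

/-- The row `(b₁, b₂)` as an operator-valued function: `B(z) u = b₁(z) u₁ + b₂(z) u₂`. -/
def row (b : Fin 2 → 𝔻 → ℂ) (z : 𝔻) : EuclideanSpace ℂ (Fin 2) →L[ℂ] ℂ :=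
  ∑ j, b j z • EuclideanSpace.proj j

/-- The point `1` of the unit circle. -/
def circleOne : UnitCircle := ⟨1, by simp⟩

/-- The point `i` of the unit circle. -/
def circleI : UnitCircle := ⟨Complex.I, by simp⟩

/-- The measure `δ_1 + δ_i` on the unit circle. -/
def twoPoint : MeasureTheory.Measure UnitCircle :=
  MeasureTheory.Measure.dirac circleOne + MeasureTheory.Measure.dirac circleI

end

end DirichletDBR

namespace DirichletDBR
open Filter Topology Finset

/-! ### Power series on the disc -/

/-! Both spaces are reproducing kernel Hilbert spaces, and such a space is determined by its kernel
(`exists_of_kernel_eq`). So it suffices to show that `K_B(·, w)` reproduces values at `w` in `D(μ)`.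

The norm of `D(μ)` becomes explicit in Taylor coefficients. For one boundary point `ζ`, the
integrand is `(1 - |z|²) |f' / (1 - ζ⁻¹ z)|²`, and division by `1 - ζ⁻¹ z` replaces coefficients by
partial sums; hence the local Dirichlet integral is `∑ |W_n|² / ((n + 1) (n + 2))` with `W_n = ∑_{1
≤ j ≤ n + 1} j a_j ζ^j` (`lintegral_local`). Thus `D(μ)` is a closed subspace of `ℓ²` (`model`).
Summation by parts then shows that a function `k`, analytic past the closed disc, is the kernel
function at `w` as soon as `k(z) + ∑_ζ ζ⁻¹ z (k(ζ) - k(z)) / (1 - ζ⁻¹ z)² = 1 / (1 - conj w z)` on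
the disc (`inner_ofCoeffs`).

It remains to check this equation for `K_B(·, w)`. With `s = x + y` and `m = x² + y²`, the relations
in `Admissible` have the following meaning. `trace` and `norm` give the spectral factorisation `|q|²
= m (|z - 1|² |z - i|² + |z - 1|² + |z - i|²)` on the circle. `cross` and `mass` give `|p₁|² + |p₂|²
= m (|z - 1|² + |z - i|²)` there, so that `|q|² - |p₁|² - |p₂|² = m |z - 1|² |z - i|²`. These two
leave a one-parameter freedom in the row, and `lead` fixes it so that the remaining polynomial
`kerRem` is a combination of `(z - 1)²` and `(z - i)²`, as the equation demands. `four_lt` puts the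
zeros of `q` outside the disc of radius 2. The relations are solved by square roots, which yields
the decimals. The Schur property follows from `K_B(z, z) = ‖e_z‖² ≥ 0`. -/

lemma hasSum_partialSum_mul_pow {a : ℕ → ℂ} {u s : ℂ} (hu : ‖u‖ < 1)
    (hs : HasSum (fun n => a n * u ^ n) s) :
    HasSum (fun n => (∑ l ∈ range (n + 1), a l) * u ^ n) (s / (1 - u)) := by
  have hg : Summable fun n : ℕ => ‖u ^ n‖ := by
    simpa [norm_pow] using summable_geometric_of_lt_one (norm_nonneg u) hu
  have h1 := summable_norm_sum_mul_range_of_summable_norm hs.summable.norm hg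
  have h2 := tsum_mul_tsum_eq_tsum_sum_range_of_summable_norm hs.summable.norm hg
  have h3 : ∀ n, ∑ k ∈ range (n + 1), a k * u ^ k * u ^ (n - k) =
      (∑ l ∈ range (n + 1), a l) * u ^ n := by
    intro n
    rw [Finset.sum_mul]
    refine Finset.sum_congr rfl fun k hk => ?_
    rw [mul_assoc, ← pow_add, Nat.add_sub_cancel' (by simpa [Nat.lt_succ_iff] using hk)]
  simp only [h3] at h1 h2
  rw [hs.tsum_eq, tsum_geometric_of_norm_lt_one hu, ← div_eq_mul_inv] at h2
  rw [h2]
  exact h1.of_norm.hasSum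

lemma hasFPowerSeriesOnBall_of_hasSum {a : ℕ → ℂ} {f : ℂ → ℂ} {R : ℝ} (hR : 0 < R)
    (h : ∀ z : ℂ, ‖z‖ < R → HasSum (fun n => a n * z ^ n) (f z)) :
    HasFPowerSeriesOnBall f (FormalMultilinearSeries.ofScalars ℂ a) 0 (ENNReal.ofReal R) where
  r_le := by
    refine ENNReal.le_of_forall_nnreal_lt fun ρ hρ => ?_
    refine FormalMultilinearSeries.le_radius_of_summable_norm _ ?_
    have hρ' : (ρ : ℝ) < R := by
      rw [← ENNReal.ofReal_coe_nnreal] at hρ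
      exact (ENNReal.ofReal_lt_ofReal_iff hR).1 hρ
    have := (h (ρ : ℝ) (by simpa using hρ')).summable.norm
    simpa [FormalMultilinearSeries.ofScalars_norm, norm_pow] using this
  r_pos := by simpa using hR
  hasSum := by
    intro y hy
    have hy' : ‖y‖ < R := by
      simpa [Metric.mem_eball, edist_zero_right, ← ofReal_norm, ENNReal.ofReal_lt_ofReal_iff hR]
        using hy
    simpa [FormalMultilinearSeries.ofScalars_apply_eq, mul_comm] using h y hy'

lemma differentiableOn_of_hasSum {a : ℕ → ℂ} {f : ℂ → ℂ} {R : ℝ} (hR : 0 < R)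
    (h : ∀ z : ℂ, ‖z‖ < R → HasSum (fun n => a n * z ^ n) (f z)) :
    DifferentiableOn ℂ f (Metric.ball 0 R) := by
  have := (hasFPowerSeriesOnBall_of_hasSum hR h).differentiableOn
  simpa [Metric.eball_ofReal] using this

lemma coeff_unique {a b : ℕ → ℂ} {f : ℂ → ℂ} {R : ℝ} (hR : 0 < R)
    (h : ∀ z : ℂ, ‖z‖ < R → HasSum (fun n => a n * z ^ n) (f z))
    (h' : ∀ z : ℂ, ‖z‖ < R → HasSum (fun n => b n * z ^ n) (f z)) : a = b := by
  have := HasFPowerSeriesAt.eq_formalMultilinearSeries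
    (hasFPowerSeriesOnBall_of_hasSum hR h).hasFPowerSeriesAt
    (hasFPowerSeriesOnBall_of_hasSum hR h').hasFPowerSeriesAt
  exact FormalMultilinearSeries.ofScalars_series_injective ℂ ℂ this

lemma hasSum_taylor {f : ℂ → ℂ} {R : ℝ} (hf : DifferentiableOn ℂ f (Metric.ball 0 R))
    {z : ℂ} (hz : ‖z‖ < R) :
    HasSum (fun n => iteratedDeriv n f 0 / (n.factorial : ℂ) * z ^ n) (f z) := by
  have := Complex.hasSum_taylorSeries_on_ball hf (z := z) (by simpa using hz)
  refine this.congr_fun fun n => ?_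
  simp only [sub_zero, smul_eq_mul]
  ring

lemma hasSum_deriv {a : ℕ → ℂ} {f : ℂ → ℂ} {R : ℝ} (hR : 0 < R)
    (h : ∀ z : ℂ, ‖z‖ < R → HasSum (fun n => a n * z ^ n) (f z)) {z : ℂ} (hz : ‖z‖ < R) :
    HasSum (fun n : ℕ => ((n + 1 : ℕ) : ℂ) * a (n + 1) * z ^ n) (deriv f z) := by
  have hd := differentiableOn_of_hasSum hR h
  have ha : a = fun n => iteratedDeriv n f 0 / (n.factorial : ℂ) :=
    coeff_unique hR h fun z hz => hasSum_taylor hd hz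
  have := hasSum_taylor (hd.deriv Metric.isOpen_ball) hz
  convert this using 2 with n
  rw [ha]
  rw [← iteratedDeriv_succ']
  beta_reduce
  rw [Nat.factorial_succ]
  push_cast
  have h1 : (n.factorial : ℂ) ≠ 0 := by exact_mod_cast n.factorial_ne_zero
  have h2 : (n : ℂ) + 1 ≠ 0 := by exact_mod_cast n.succ_ne_zero
  field_simp

lemma extendZero_coe {E : Type*} [Zero E] (f : 𝔻 → E) (z : 𝔻) : extendZero f z = f z :=
  Complex.UnitDisc.coe_injective.extend_apply _ _ _

lemma hasSum_taylorCoeff {f : 𝔻 → ℂ} (hf : Holomorphic f) {z : ℂ} (hz : ‖z‖ < 1) :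
    HasSum (fun n => taylorCoeff f n * z ^ n) (extendZero f z) :=
  hasSum_taylor hf hz

lemma holomorphic_of_hasSum {a : ℕ → ℂ} {f : 𝔻 → ℂ}
    (h : ∀ z : 𝔻, HasSum (fun n => a n * (z : ℂ) ^ n) (f z)) :
    Holomorphic f ∧ taylorCoeff f = a := by
  have h' : ∀ z : ℂ, ‖z‖ < 1 → HasSum (fun n => a n * z ^ n) (extendZero f z) := by
    intro z hz
    have := h (Complex.UnitDisc.mk z hz)
    rw [← extendZero_coe f] at this
    simpa using this
  have hd : Holomorphic f := differentiableOn_of_hasSum one_pos h'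
  exact ⟨hd, coeff_unique one_pos (fun z hz => hasSum_taylorCoeff hd hz) h'⟩

end DirichletDBR

namespace DirichletDBR
open Filter Topology Finset MeasureTheory

/-! ### Area integrals and the local Dirichlet integral -/

/-- Parseval's identity on the circle of radius `ρ`. -/
lemma circleAverage_norm_sq {c : ℕ → ℂ} {g : ℂ → ℂ}
    (h : ∀ z : ℂ, ‖z‖ < 1 → HasSum (fun n => c n * z ^ n) (g z)) {ρ : ℝ} (h0 : 0 ≤ ρ)
    (h1 : ρ < 1) :
    HasSum (fun n => ‖c n‖ ^ 2 * ρ ^ (2 * n)) (Real.circleAverage (fun z => ‖g z‖ ^ 2) 0 ρ) := by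
  have hsum : Summable fun n => ‖c n‖ * ρ ^ n := by
    have := (h (ρ : ℂ) (by simpa [abs_of_nonneg h0] using h1)).summable.norm
    simpa [abs_of_nonneg h0] using this
  rw [hasSum_iff_tendsto_nat_of_nonneg (fun n => by positivity)]
  -- Truncations of the rescaled series `z ↦ g (ρ z)`: Parseval for polynomials applies to them on
  -- the unit circle, and `∑ ‖c n‖ ρ ^ n` dominates for the limit.
  set P : ℕ → Polynomial ℂ := fun N => ∑ n ∈ range N, Polynomial.monomial n (c n * (ρ : ℂ) ^ n)
    with hP
  have hcoeff : ∀ N n, (P N).coeff n = if n < N then c n * (ρ : ℂ) ^ n else 0 := by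
    intro N n
    simp [hP, Polynomial.coeff_monomial]
  have hpars : ∀ N, ∑ n ∈ range N, ‖c n‖ ^ 2 * ρ ^ (2 * n) =
      Real.circleAverage (fun z => ‖(P N).eval z‖ ^ 2) 0 1 := by
    intro N
    rw [← Polynomial.sum_sq_norm_coeff_eq_circleAverage]
    symm
    have hsub : (P N).support ⊆ range N := by
      intro n hn
      by_contra hcon
      rw [Polynomial.mem_support_iff, hcoeff] at hn
      simp at hcon hn
      omega
    rw [Finset.sum_subset hsub]
    · refine Finset.sum_congr rfl fun n hn => ?_
      rw [hcoeff, if_pos (by simpa using hn), norm_mul, norm_pow, Complex.norm_real,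
        Real.norm_of_nonneg h0]
      ring
    · intro n _ hn
      simp [Polynomial.notMem_support_iff.1 hn]
  have heval : ∀ N z, (P N).eval z = ∑ n ∈ range N, c n * (ρ * z) ^ n := by
    intro N z
    simp only [hP, Polynomial.eval_finsetSum, Polynomial.eval_monomial]
    refine Finset.sum_congr rfl fun n _ => ?_
    ring
  simp_rw [hpars, Real.circleAverage_def]
  refine Tendsto.const_smul ?_ _
  refine intervalIntegral.tendsto_integral_filter_of_dominated_convergence
    (fun _ => (∑' n, ‖c n‖ * ρ ^ n) ^ 2) ?_ ?_ ?_ ?_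
  · refine Eventually.of_forall fun N => ?_
    refine Continuous.aestronglyMeasurable ?_
    have := (P N).continuous
    have := continuous_circleMap 0 1
    fun_prop
  · refine Eventually.of_forall fun N => Eventually.of_forall fun θ _ => ?_
    rw [Real.norm_of_nonneg (by positivity)]
    gcongr
    rw [heval]
    refine (norm_sum_le _ _).trans ?_
    refine le_trans (Finset.sum_le_sum fun n _ => ?_) (hsum.sum_le_tsum (range N) fun n _ => by positivity)
    simp [circleMap, abs_of_nonneg h0]
  · exact intervalIntegrable_const
  · refine Eventually.of_forall fun θ _ => ?_
    refine Tendsto.pow (Tendsto.norm ?_) 2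
    simp_rw [heval]
    have : circleMap 0 ρ θ = ρ * circleMap 0 1 θ := by simp [circleMap]
    rw [this]
    refine (h _ ?_).tendsto_sum_nat
    simpa [circleMap, abs_of_nonneg h0] using h1

lemma lintegral_circle {c : ℕ → ℂ} {g : ℂ → ℂ}
    (h : ∀ z : ℂ, ‖z‖ < 1 → HasSum (fun n => c n * z ^ n) (g z)) {ρ : ℝ} (h0 : 0 ≤ ρ)
    (h1 : ρ < 1) :
    ∫⁻ θ in Set.Ioo (-Real.pi) Real.pi, ‖g (Complex.polarCoord.symm (ρ, θ))‖ₑ ^ 2 =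
      ENNReal.ofReal (2 * Real.pi) * ∑' n, ENNReal.ofReal (‖c n‖ ^ 2 * ρ ^ (2 * n)) := by
  have hs := circleAverage_norm_sq h h0 h1
  have hpt : ∀ θ : ℝ, Complex.polarCoord.symm (ρ, θ) = circleMap 0 ρ θ := by
    intro θ
    rw [Complex.polarCoord_symm_apply, circleMap, Complex.exp_mul_I]
    push_cast
    ring
  have hcont : Continuous fun θ : ℝ => g (circleMap 0 ρ θ) := by
    refine (differentiableOn_of_hasSum one_pos h).continuousOn.comp_continuous
      (continuous_circleMap 0 ρ) fun θ => ?_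
    simpa [circleMap, abs_of_nonneg h0] using h1
  have hper : Function.Periodic (fun θ : ℝ => ‖g (circleMap 0 ρ θ)‖ ^ 2) (2 * Real.pi) := by
    intro θ
    simp only [periodic_circleMap 0 ρ θ]
  rw [← ENNReal.ofReal_tsum_of_nonneg (fun n => by positivity) hs.summable, hs.tsum_eq,
    ← ENNReal.ofReal_mul (by positivity), Real.circleAverage_def]
  have e2 : ∫ θ in (0:ℝ)..2 * Real.pi, ‖g (circleMap 0 ρ θ)‖ ^ 2 =
      ∫ θ in Set.Ioo (-Real.pi) Real.pi, ‖g (circleMap 0 ρ θ)‖ ^ 2 := by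
    have := hper.intervalIntegral_add_eq 0 (-Real.pi)
    rw [zero_add] at this
    rw [this, intervalIntegral.integral_of_le (by linarith [Real.pi_pos]),
      integral_Ioc_eq_integral_Ioo]
    congr 3
    ring
  rw [smul_eq_mul, mul_inv_cancel_left₀ (by positivity), e2,
    ofReal_integral_eq_lintegral_ofReal]
  · simp_rw [hpt]
    refine lintegral_congr fun θ => ?_
    rw [ENNReal.ofReal_pow (norm_nonneg _), ofReal_norm]
  · refine IntegrableOn.mono_set (t := Set.Icc (-Real.pi) Real.pi) ?_ Set.Ioo_subset_Icc_self
    exact (hcont.norm.pow 2).continuousOn.integrableOn_compact isCompact_Icc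
  · exact Eventually.of_forall fun θ => by positivity

lemma lintegral_radial (n : ℕ) :
    ∫⁻ ρ in Set.Ioo (0 : ℝ) 1, ENNReal.ofReal (2 * ρ * (1 - ρ ^ 2) * ρ ^ (2 * n)) =
      ENNReal.ofReal (1 / ((n + 1) * (n + 2))) := by
  have hc : Continuous fun ρ : ℝ => 2 * ρ * (1 - ρ ^ 2) * ρ ^ (2 * n) := by fun_prop
  rw [← ofReal_integral_eq_lintegral_ofReal]
  · congr 1
    rw [← integral_Ioc_eq_integral_Ioo, ← intervalIntegral.integral_of_le zero_le_one]
    have : (fun ρ : ℝ => 2 * ρ * (1 - ρ ^ 2) * ρ ^ (2 * n)) =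
        fun ρ => 2 * ρ ^ (2 * n + 1) - 2 * ρ ^ (2 * n + 3) := by
      funext ρ; ring
    rw [this, intervalIntegral.integral_sub (Continuous.intervalIntegrable (by fun_prop) _ _)
      (Continuous.intervalIntegrable (by fun_prop) _ _),
      intervalIntegral.integral_const_mul, intervalIntegral.integral_const_mul, integral_pow,
      integral_pow]
    have h1 : (n : ℝ) + 1 ≠ 0 := by positivity
    have h2 : (n : ℝ) + 2 ≠ 0 := by positivity
    push_cast
    have h3 : (2 * (n:ℝ) + 1 + 1) ≠ 0 := by positivity
    have h4 : (2 * (n:ℝ) + 3 + 1) ≠ 0 := by positivity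
    simp only [one_pow, ne_eq, Nat.add_eq_zero_iff, one_ne_zero, and_false, not_false_eq_true, zero_pow]
    field_simp
    ring
  · exact (hc.continuousOn.integrableOn_compact isCompact_Icc).mono_set Set.Ioo_subset_Icc_self
  · refine (ae_restrict_iff' measurableSet_Ioo).2 (Eventually.of_forall fun ρ hρ => ?_)
    have : 0 ≤ 1 - ρ ^ 2 := by nlinarith [hρ.1, hρ.2]
    have := hρ.1.le
    positivity

/-- In polar coordinates, Parseval on each circle leaves the Beta integral of `lintegral_radial` as
the weight of `‖c n‖ ^ 2`. -/
lemma lintegral_norm_sq_mul {c : ℕ → ℂ} {g : ℂ → ℂ}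
    (h : ∀ z : ℂ, ‖z‖ < 1 → HasSum (fun n => c n * z ^ n) (g z)) :
    ∫⁻ z in Metric.ball (0 : ℂ) 1, ‖g z‖ₑ ^ 2 * ENNReal.ofReal (1 - ‖z‖ ^ 2) ∂areaMeasure =
      ∑' n : ℕ, ENNReal.ofReal (‖c n‖ ^ 2 / ((n + 1) * (n + 2))) := by
  have hgm : AEMeasurable (fun p : ℝ × ℝ => g (Complex.polarCoord.symm p))
      ((volume.restrict (Set.Ioo (0:ℝ) 1)).prod (volume.restrict (Set.Ioo (-Real.pi) Real.pi))) := by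
    rw [Measure.prod_restrict]
    refine ContinuousOn.aemeasurable ?_ (measurableSet_Ioo.prod measurableSet_Ioo)
    refine (differentiableOn_of_hasSum one_pos h).continuousOn.comp
      (Continuous.continuousOn ?_) ?_
    · have : (Complex.polarCoord.symm : ℝ × ℝ → ℂ) =
          fun p : ℝ × ℝ => (p.1 : ℂ) * (Real.cos p.2 + Real.sin p.2 * Complex.I) := by
        funext p; exact Complex.polarCoord_symm_apply p
      rw [this]
      fun_prop
    · rintro ⟨ρ, θ⟩ ⟨hρ, -⟩
      simp only [Metric.mem_ball, dist_zero_right, Complex.norm_polarCoord_symm]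
      rw [abs_of_pos hρ.1]; exact hρ.2
  rw [areaMeasure, Measure.restrict_smul, lintegral_smul_measure,
    ← lintegral_indicator Metric.isOpen_ball.measurableSet,
    ← Complex.lintegral_comp_polarCoord_symm]
  have key : ∫⁻ p in polarCoord.target, ENNReal.ofReal p.1 •
      (Metric.ball (0 : ℂ) 1).indicator
        (fun z => ‖g z‖ₑ ^ 2 * ENNReal.ofReal (1 - ‖z‖ ^ 2)) (Complex.polarCoord.symm p) =
      ∫⁻ p in Set.Ioo (0:ℝ) 1 ×ˢ Set.Ioo (-Real.pi) Real.pi,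
        ENNReal.ofReal (p.1 * (1 - p.1 ^ 2)) * ‖g (Complex.polarCoord.symm p)‖ₑ ^ 2 := by
    rw [← lintegral_indicator polarCoord.open_target.measurableSet,
      ← lintegral_indicator (measurableSet_Ioo.prod measurableSet_Ioo)]
    refine lintegral_congr fun p => ?_
    by_cases hp : p ∈ polarCoord.target
    · rw [Set.indicator_of_mem hp]
      rw [polarCoord_target] at hp
      have hp1 : 0 < p.1 := hp.1
      by_cases hp2 : p.1 < 1
      · rw [Set.indicator_of_mem (by simpa [abs_of_pos hp1] using hp2),
          Set.indicator_of_mem (show p ∈ Set.Ioo (0 : ℝ) 1 ×ˢ Set.Ioo (-Real.pi) Real.pi from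
            ⟨⟨hp1, hp2⟩, hp.2⟩), Complex.norm_polarCoord_symm, sq_abs,
          ENNReal.ofReal_mul hp1.le, smul_eq_mul]
        ring
      · rw [Set.indicator_of_notMem (by simpa [abs_of_pos hp1] using hp2),
          Set.indicator_of_notMem (fun hh => hp2 hh.1.2), smul_zero]
    · rw [Set.indicator_of_notMem hp, Set.indicator_of_notMem]
      rintro ⟨ha, hb⟩
      exact hp (by rw [polarCoord_target]; exact ⟨ha.1, hb⟩)
  rw [key, Measure.volume_eq_prod, ← Measure.prod_restrict, lintegral_prod]
  swap
  · exact ((by fun_prop : Measurable fun p : ℝ × ℝ => ENNReal.ofReal (p.1 * (1 - p.1 ^ 2))).aemeasurable).mul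
      (hgm.enorm.pow_const 2)
  have inner : ∀ ρ ∈ Set.Ioo (0:ℝ) 1, ∫⁻ θ in Set.Ioo (-Real.pi) Real.pi,
      ENNReal.ofReal (ρ * (1 - ρ ^ 2)) * ‖g (Complex.polarCoord.symm (ρ, θ))‖ₑ ^ 2 =
      ∑' n : ℕ, ENNReal.ofReal (Real.pi * ‖c n‖ ^ 2) *
        ENNReal.ofReal (2 * ρ * (1 - ρ ^ 2) * ρ ^ (2 * n)) := by
    intro ρ hρ
    rw [lintegral_const_mul' _ _ ENNReal.ofReal_ne_top, lintegral_circle h hρ.1.le hρ.2,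
      ← ENNReal.tsum_mul_left, ← ENNReal.tsum_mul_left]
    refine tsum_congr fun n => ?_
    have : 0 ≤ 1 - ρ ^ 2 := by nlinarith [hρ.1, hρ.2]
    have := hρ.1.le
    rw [← ENNReal.ofReal_mul (by positivity), ← ENNReal.ofReal_mul (by positivity),
      ← ENNReal.ofReal_mul (by positivity)]
    congr 1
    ring
  rw [setLIntegral_congr_fun measurableSet_Ioo inner, lintegral_tsum
    (fun n => (Measurable.aemeasurable (by fun_prop))), smul_eq_mul, ← ENNReal.tsum_mul_left]
  refine tsum_congr fun n => ?_
  rw [lintegral_const_mul' _ _ ENNReal.ofReal_ne_top, lintegral_radial,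
    ← ENNReal.ofReal_inv_of_pos Real.pi_pos, ← ENNReal.ofReal_mul (by positivity),
    ← ENNReal.ofReal_mul (by positivity)]
  congr 1
  have := Real.pi_ne_zero
  field_simp

end DirichletDBR

/-! ### Coefficient formula for the local Dirichlet integral. -/

namespace DirichletDBR
open Filter Topology Finset MeasureTheory

/-- The numerators `∑_{1 ≤ j ≤ n + 1} j a_j ζ ^ j` in the coefficient formula for the local
Dirichlet integral at `ζ`. -/
noncomputable def weightedSum (ζ : ℂ) (a : ℕ → ℂ) (n : ℕ) : ℂ :=
  ∑ j ∈ range (n + 1), ((j + 1 : ℕ) : ℂ) * a (j + 1) * ζ ^ (j + 1)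

lemma weightedSum_succ (ζ : ℂ) (a : ℕ → ℂ) (n : ℕ) :
    weightedSum ζ a (n + 1) =
      weightedSum ζ a n + ((n + 2 : ℕ) : ℂ) * a (n + 2) * ζ ^ (n + 2) :=
  Finset.sum_range_succ _ _

lemma norm_circle (ζ : UnitCircle) : ‖(ζ : ℂ)‖ = 1 := by simp

lemma poissonIntegral_sum_dirac {κ : Type*} [Fintype κ] (ζ : κ → UnitCircle) (z : ℂ) :
    poissonIntegral (∑ i, Measure.dirac (ζ i)) z =
      ∑ i, (1 - ‖z‖ ^ 2) / ‖z - (ζ i : ℂ)‖ ^ 2 := by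
  rw [poissonIntegral, integral_finsetSum_measure]
  · simp [integral_dirac]
  · intro i _
    exact integrable_dirac (by simp)

/-- Coefficient formula for the Dirichlet integral at one boundary point. -/
lemma lintegral_local {f : 𝔻 → ℂ} (hf : Holomorphic f) (ζ : UnitCircle) :
    ∫⁻ z in Metric.ball (0 : ℂ) 1, ‖deriv (extendZero f) z‖ₑ ^ 2 *
        ENNReal.ofReal ((1 - ‖z‖ ^ 2) / ‖z - (ζ : ℂ)‖ ^ 2) ∂areaMeasure =
      ∑' n : ℕ, ENNReal.ofReal
        (‖weightedSum ζ (taylorCoeff f) n‖ ^ 2 / ((n + 1) * (n + 2))) := by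
  have hζ := norm_circle ζ
  have hζ0 : (ζ : ℂ) ≠ 0 := norm_ne_zero_iff.1 (by rw [hζ]; exact one_ne_zero)
  set a := taylorCoeff f
  have hg : ∀ z : ℂ, ‖z‖ < 1 →
      HasSum (fun n => weightedSum ζ a n * (ζ : ℂ)⁻¹ ^ (n + 1) * z ^ n)
        (deriv (extendZero f) z / (1 - (ζ : ℂ)⁻¹ * z)) := by
    intro z hz
    have h1 : HasSum (fun n : ℕ => ((n + 1 : ℕ) : ℂ) * a (n + 1) * (ζ : ℂ) ^ (n + 1) *
        ((ζ : ℂ)⁻¹ * z) ^ n) (ζ * deriv (extendZero f) z) := by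
      have : HasSum (fun n : ℕ => (ζ : ℂ) * (((n + 1 : ℕ) : ℂ) * a (n + 1) * z ^ n))
          (ζ * deriv (extendZero f) z) :=
        (hasSum_deriv one_pos (fun z hz => hasSum_taylorCoeff hf hz) hz).mul_left (ζ : ℂ)
      refine HasSum.congr_fun this ?_
      intro n
      rw [mul_pow, inv_pow]
      field_simp
      ring
    have h2 := (hasSum_partialSum_mul_pow (by simpa [hζ] using hz) h1).mul_left (ζ : ℂ)⁻¹
    rw [mul_div_assoc, inv_mul_cancel_left₀ hζ0] at h2
    refine HasSum.congr_fun h2 ?_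
    intro n
    rw [weightedSum, mul_pow, pow_succ]
    ring
  have hnorm : ∀ n, ‖weightedSum ζ a n * (ζ : ℂ)⁻¹ ^ (n + 1)‖ = ‖weightedSum ζ a n‖ := by
    intro n; simp [hζ]
  have := lintegral_norm_sq_mul hg
  simp only [hnorm] at this
  rw [← this]
  refine setLIntegral_congr_fun Metric.isOpen_ball.measurableSet fun z hz => ?_
  have hz : ‖z‖ < 1 := by simpa using hz
  have h1 : ‖1 - (ζ : ℂ)⁻¹ * z‖ = ‖z - ζ‖ := by
    rw [show 1 - (ζ : ℂ)⁻¹ * z = -((ζ : ℂ)⁻¹ * (z - ζ)) by field_simp; ring]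
    simp [hζ]
  have h2 : 0 ≤ 1 - ‖z‖ ^ 2 := by nlinarith [norm_nonneg z]
  simp only [← ofReal_norm]
  rw [← ENNReal.ofReal_pow (norm_nonneg _), ← ENNReal.ofReal_pow (norm_nonneg _),
    ← ENNReal.ofReal_mul (by positivity), ← ENNReal.ofReal_mul (by positivity), norm_div, h1]
  congr 1
  ring

lemma dirichletIntegral_sum_dirac {κ : Type*} [Fintype κ] (ζ : κ → UnitCircle) {f : 𝔻 → ℂ}
    (hf : Holomorphic f) :
    dirichletIntegral (∑ i, Measure.dirac (ζ i)) f =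
      ∑ i, ∑' n : ℕ, ENNReal.ofReal
        (‖weightedSum (ζ i) (taylorCoeff f) n‖ ^ 2 / ((n + 1) * (n + 2))) := by
  simp_rw [← lintegral_local hf]
  have hm : AEMeasurable (deriv (extendZero f)) (areaMeasure.restrict (Metric.ball 0 1)) :=
    (measurable_deriv _).aemeasurable
  rw [dirichletIntegral, ← lintegral_finsetSum']
  · refine setLIntegral_congr_fun Metric.isOpen_ball.measurableSet fun z hz => ?_
    have hz : ‖z‖ < 1 := by simpa using hz
    have h2 : 0 ≤ 1 - ‖z‖ ^ 2 := by nlinarith [norm_nonneg z]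
    rw [poissonIntegral_sum_dirac, ENNReal.ofReal_sum_of_nonneg (fun i _ => by positivity),
      Finset.mul_sum]
  · intro i _
    exact (hm.enorm.pow_const 2).mul (Measurable.aemeasurable (by fun_prop))

/-- Finiteness of a local Dirichlet integral forces the Taylor coefficients to be square summable. -/
lemma summable_sq_of_weightedSum {ζ : ℂ} (hζ : ‖ζ‖ = 1) {a : ℕ → ℂ}
    (h : Summable fun n : ℕ => ‖weightedSum ζ a n‖ ^ 2 / ((n + 1) * (n + 2) : ℝ)) :
    Summable fun n => ‖a n‖ ^ 2 := by
  -- The difference of consecutive weighted sums isolates `(n + 2) a_{n+2}`; the first two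
  -- coefficients do not matter for summability.
  rw [← summable_nat_add_iff 2]
  refine Summable.of_nonneg_of_le (fun n => by positivity) (fun n => ?_)
    (((summable_nat_add_iff 1).2 h).mul_left 4 |>.add (h.mul_left 2))
  set S := ‖weightedSum ζ a n‖
  set S' := ‖weightedSum ζ a (n + 1)‖
  have h1 : (n + 2 : ℝ) * ‖a (n + 2)‖ ≤ S' + S := by
    have : ((n + 2 : ℕ) : ℂ) * a (n + 2) * ζ ^ (n + 2) =
        weightedSum ζ a (n + 1) - weightedSum ζ a n := by
      rw [weightedSum_succ]; ring
    have h2 := congrArg norm this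
    rw [norm_mul, norm_mul, norm_pow, hζ, one_pow, mul_one, Complex.norm_natCast] at h2
    push_cast at h2
    rw [h2]
    exact norm_sub_le _ _
  have hsq : ((n + 2 : ℝ) * ‖a (n + 2)‖) ^ 2 ≤ 2 * S' ^ 2 + 2 * S ^ 2 :=
    (pow_le_pow_left₀ (by positivity) h1 2).trans (by nlinarith [sq_nonneg (S' - S)])
  have hn : (0 : ℝ) ≤ n := n.cast_nonneg
  have e1 : 2 * S' ^ 2 / (n + 2 : ℝ) ^ 2 ≤
      4 * (S' ^ 2 / (((n + 1 : ℕ) + 1 : ℝ) * ((n + 1 : ℕ) + 2))) := by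
    push_cast
    rw [← mul_div_assoc, div_le_div_iff₀ (by positivity) (by positivity)]
    nlinarith [mul_nonneg (sq_nonneg S') (by positivity : (0:ℝ) ≤ (n + 2) * (n + 1))]
  have e2 : 2 * S ^ 2 / (n + 2 : ℝ) ^ 2 ≤ 2 * (S ^ 2 / ((n + 1 : ℝ) * (n + 2))) := by
    rw [← mul_div_assoc]
    gcongr
    nlinarith
  calc ‖a (n + 2)‖ ^ 2 = ((n + 2 : ℝ) * ‖a (n + 2)‖) ^ 2 / (n + 2 : ℝ) ^ 2 := by
        field_simp
    _ ≤ (2 * S' ^ 2 + 2 * S ^ 2) / (n + 2 : ℝ) ^ 2 := by gcongr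
    _ = 2 * S' ^ 2 / (n + 2 : ℝ) ^ 2 + 2 * S ^ 2 / (n + 2 : ℝ) ^ 2 := add_div _ _ _
    _ ≤ _ := add_le_add e1 e2

end DirichletDBR

namespace DirichletDBR
open Filter Topology Finset MeasureTheory

/-! ### The space `D(μ)` as a space of sequences, for `μ` a finite sum of point masses -/

variable {κ : Type*}

/-- The coordinates of a power series in the model of `D(∑ δ_{ζ i})` inside `ℓ²`. -/
noncomputable def coords (ζ : κ → UnitCircle) (a : ℕ → ℂ) : Option κ × ℕ → ℂ
  | (none, n) => a n
  | (some i, n) => weightedSum (ζ i) a n / (Real.sqrt ((n + 1) * (n + 2)) : ℝ)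

lemma norm_coords_some (ζ : κ → UnitCircle) (a : ℕ → ℂ) (i : κ) (n : ℕ) :
    ‖coords ζ a (some i, n)‖ ^ 2 = ‖weightedSum (ζ i) a n‖ ^ 2 / ((n + 1) * (n + 2)) := by
  rw [coords, norm_div, div_pow, Complex.norm_real, Real.norm_of_nonneg (Real.sqrt_nonneg _),
    Real.sq_sqrt (by positivity)]

/-- The closed subspace of `ℓ²` consisting of the coordinate families of power series. -/
noncomputable def model (ζ : κ → UnitCircle) :
    Submodule ℂ (lp (fun _ : Option κ × ℕ => ℂ) 2) where
  carrier := {x | ∀ j, x j = coords ζ (fun n => x (none, n)) j}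
  add_mem' := by
    rintro x y hx hy ⟨_ | i, n⟩
    · rfl
    · have hx := hx (some i, n)
      have hy := hy (some i, n)
      simp only [coords, weightedSum] at hx hy ⊢
      simp only [lp.coeFn_add, Pi.add_apply, hx, hy, mul_add, add_mul, Finset.sum_add_distrib,
        add_div]
  zero_mem' := by
    rintro ⟨_ | i, n⟩
    · rfl
    · simp [coords, weightedSum]
  smul_mem' := by
    rintro c x hx ⟨_ | i, n⟩
    · rfl
    · have hx := hx (some i, n)
      simp only [coords, weightedSum] at hx ⊢
      simp only [lp.coeFn_smul, Pi.smul_apply, hx, smul_eq_mul, ← mul_div_assoc, Finset.mul_sum]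
      congr 1
      exact Finset.sum_congr rfl fun j _ => by ring

lemma continuous_coords (ζ : κ → UnitCircle) (j : Option κ × ℕ) :
    Continuous fun a : ℕ → ℂ => coords ζ a j := by
  rcases j with ⟨_ | i, n⟩
  · exact continuous_apply n
  · simp only [coords, weightedSum, div_eq_mul_inv]
    fun_prop

lemma isClosed_model (ζ : κ → UnitCircle) :
    IsClosed (model ζ : Set (lp (fun _ : Option κ × ℕ => ℂ) 2)) := by
  have hc : ∀ j, Continuous fun x : lp (fun _ : Option κ × ℕ => ℂ) 2 => x j := fun j =>
    (lp.evalCLM ℂ (fun _ : Option κ × ℕ => ℂ) 2 j).continuous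
  have : (model ζ : Set (lp (fun _ : Option κ × ℕ => ℂ) 2)) =
      ⋂ j, {x | x j = coords ζ (fun n => x (none, n)) j} := by
    ext x
    simp only [Set.mem_iInter, Set.mem_ofPred_eq]
    rfl
  rw [this]
  exact isClosed_iInter fun j =>
    isClosed_eq (hc j) ((continuous_coords ζ j).comp (continuous_pi fun n => hc (none, n)))

instance (ζ : κ → UnitCircle) : CompleteSpace (model ζ) :=
  (isClosed_model ζ).completeSpace_coe

/-- The sequence of Taylor coefficients of an element of the model. -/
def coeffs {ζ : κ → UnitCircle} (x : model ζ) (n : ℕ) : ℂ := x.1 (none, n)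

lemma coords_coeffs {ζ : κ → UnitCircle} (x : model ζ) (j : Option κ × ℕ) :
    coords ζ (coeffs x) j = x.1 j := (x.2 j).symm

/-- The element of the model with given Taylor coefficients. -/
noncomputable def ofCoeffs {ζ : κ → UnitCircle} (a : ℕ → ℂ) (ha : Memℓp (coords ζ a) 2) : model ζ :=
  ⟨⟨coords ζ a, ha⟩, fun _ => rfl⟩

lemma coeffs_ofCoeffs {ζ : κ → UnitCircle} (a : ℕ → ℂ) (ha : Memℓp (coords ζ a) 2) :
    coeffs (ofCoeffs a ha) = a := rfl

lemma memℓp_coords_iff (ζ : κ → UnitCircle) (a : ℕ → ℂ) :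
    Memℓp (coords ζ a) 2 ↔ Summable fun j => ‖coords ζ a j‖ ^ 2 := by
  rw [memℓp_gen_iff (by norm_num)]
  norm_num

lemma summable_coeffs {ζ : κ → UnitCircle} (x : model ζ) {z : ℂ} (hz : ‖z‖ < 1) :
    Summable fun n => coeffs x n * z ^ n := by
  refine Summable.of_norm_bounded
    ((summable_geometric_of_lt_one (norm_nonneg z) hz).mul_left ‖x‖) fun n => ?_
  rw [norm_mul, norm_pow]
  gcongr
  exact lp.norm_apply_le_norm (by norm_num) x.1 _

lemma ofReal_norm_sq {ζ : κ → UnitCircle} (x : model ζ) :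
    ENNReal.ofReal (‖x‖ ^ 2) = ∑' j, ENNReal.ofReal (‖coords ζ (coeffs x) j‖ ^ 2) := by
  have h := lp.hasSum_norm (p := 2) (by norm_num) x.1
  norm_num at h
  simp only [coords_coeffs]
  rw [← ENNReal.ofReal_tsum_of_nonneg (fun j => by positivity) h.summable, h.tsum_eq]
  rfl

lemma dirichletNormSq_eq [Fintype κ] (ζ : κ → UnitCircle) {f : 𝔻 → ℂ} (hf : Holomorphic f) :
    dirichletNormSq (∑ i, Measure.dirac (ζ i)) f =
      ∑' j, ENNReal.ofReal (‖coords ζ (taylorCoeff f) j‖ ^ 2) := by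
  rw [ENNReal.tsum_prod', tsum_fintype, Fintype.sum_option, dirichletNormSq,
    dirichletIntegral_sum_dirac ζ hf]
  simp only [norm_coords_some]
  congr 1
  refine tsum_congr fun n => ?_
  rw [ENNReal.ofReal_pow (norm_nonneg _), ofReal_norm]
  rfl

lemma memℓp_of_mem_dirichletSpace [Fintype κ] [Nonempty κ] (ζ : κ → UnitCircle) {f : 𝔻 → ℂ}
    (hf : f ∈ dirichletSpace (∑ i, Measure.dirac (ζ i))) :
    Memℓp (coords ζ (taylorCoeff f)) 2 := by
  obtain ⟨hf, hfin⟩ := hf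
  have hfin' := hfin
  rw [dirichletIntegral_sum_dirac ζ hf, ENNReal.sum_lt_top] at hfin'
  have hs : ∀ i, Summable fun n : ℕ =>
      ‖weightedSum (ζ i) (taylorCoeff f) n‖ ^ 2 / ((n + 1) * (n + 2) : ℝ) := fun i => by
    have := ENNReal.summable_toReal (hfin' i (Finset.mem_univ i)).ne
    refine this.congr fun n => ENNReal.toReal_ofReal (by positivity)
  obtain ⟨i⟩ := ‹Nonempty κ›
  -- Membership in the space only asks for a finite Dirichlet integral; finiteness of the Hardy norm
  -- comes from any single point mass.
  have ha := summable_sq_of_weightedSum (norm_circle (ζ i)) (hs i)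
  rw [memℓp_coords_iff]
  have : ∑' j, ENNReal.ofReal (‖coords ζ (taylorCoeff f) j‖ ^ 2) ≠ ⊤ := by
    rw [← dirichletNormSq_eq ζ hf, dirichletNormSq]
    refine ENNReal.add_ne_top.2 ⟨?_, hfin.ne⟩
    rw [hardyNormSq]
    simp_rw [← ofReal_norm, ← ENNReal.ofReal_pow (norm_nonneg _)]
    exact ha.tsum_ofReal_ne_top
  exact (ENNReal.summable_toReal this).congr fun j => ENNReal.toReal_ofReal (by positivity)

end DirichletDBR

namespace DirichletDBR
open Filter Topology Finset MeasureTheory ComplexConjugate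

/-! ### Summation by parts and the reproducing property -/

/-- The tails `∑_{l > n} a_l ζ ^ l`, where `s` is the sum of the whole series. -/
noncomputable def tail (ζ : ℂ) (a : ℕ → ℂ) (s : ℂ) (n : ℕ) : ℂ :=
  s - ∑ l ∈ range (n + 1), a l * ζ ^ l

/-- Partial sums of the sequence of tails. -/
noncomputable def tailSum (ζ : ℂ) (a : ℕ → ℂ) (s : ℂ) (n : ℕ) : ℂ :=
  ∑ l ∈ range n, tail ζ a s l

lemma tail_succ (ζ : ℂ) (a : ℕ → ℂ) (s : ℂ) (n : ℕ) :
    tail ζ a s (n + 1) = tail ζ a s n - a (n + 1) * ζ ^ (n + 1) := by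
  rw [tail, Finset.sum_range_succ, tail]; ring

lemma tailSum_succ (ζ : ℂ) (a : ℕ → ℂ) (s : ℂ) (n : ℕ) :
    tailSum ζ a s (n + 1) = tailSum ζ a s n + tail ζ a s n :=
  Finset.sum_range_succ _ _

/-- Abel summation. The value of `s` is immaterial, since changing it alters both terms on the right
by the same amount. -/
lemma weightedSum_eq_tailSum (ζ : ℂ) (a : ℕ → ℂ) (s : ℂ) (n : ℕ) :
    weightedSum ζ a n = tailSum ζ a s (n + 1) - (n + 1) * tail ζ a s (n + 1) := by
  induction n with
  | zero => simp [weightedSum, tailSum, tail_succ]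
  | succ n ih =>
    rw [weightedSum_succ, ih, tailSum_succ _ _ _ (n + 1), tail_succ _ _ _ (n + 1)]
    push_cast
    ring

/-- Writing `T` for `tailSum ζ b s`, `weightedSum_eq_tailSum` says that `W_n(b) / ((n + 1) (n + 2))`
is the telescoping difference `T_{n+1} / (n + 1) - T_{n+2} / (n + 2)`. Moving the difference onto
`W_n(a)`, whose increments are `(n + 1) a_{n+1} ζ ^ (n + 1)`, cancels the weights and leaves one
boundary term. -/
lemma sum_weightedSum_mul_conj (ζ : ℂ) (a b : ℕ → ℂ) (s : ℂ) (N : ℕ) :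
    ∑ n ∈ range (N + 1), weightedSum ζ a n * conj (weightedSum ζ b n) / ((n + 1) * (n + 2)) =
      ∑ n ∈ range (N + 1), a (n + 1) * ζ ^ (n + 1) * conj (tailSum ζ b s (n + 1)) -
        weightedSum ζ a N * conj (tailSum ζ b s (N + 2)) / (N + 2) := by
  induction N with
  | zero =>
    simp only [zero_add, Finset.sum_range_one, weightedSum_eq_tailSum ζ b s,
      tailSum_succ ζ b s 1]
    simp [weightedSum]
    ring
  | succ N ih =>
    rw [Finset.sum_range_succ, ih, Finset.sum_range_succ _ (N + 1), weightedSum_succ ζ a,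
      weightedSum_eq_tailSum ζ b s (N + 1), tailSum_succ ζ b s (N + 2)]
    have h2 : (N : ℂ) + 2 ≠ 0 := by exact_mod_cast (N + 1).succ_ne_zero
    have h3 : (N : ℂ) + 3 ≠ 0 := by exact_mod_cast (N + 2).succ_ne_zero
    have h2' : (N : ℂ) + 1 + 1 ≠ 0 := by exact_mod_cast (N + 1).succ_ne_zero
    have h3' : (N : ℂ) + 1 + 2 ≠ 0 := by exact_mod_cast (N + 2).succ_ne_zero
    push_cast
    simp only [map_sub, map_add, map_mul, map_natCast, map_one]
    field_simp
    ring

lemma exists_geometric_bound {a : ℕ → ℂ} {k : ℂ → ℂ} {R : ℝ} (hR : 1 < R)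
    (h : ∀ z : ℂ, ‖z‖ < R → HasSum (fun n => a n * z ^ n) (k z)) :
    ∃ C ρ : ℝ, 0 ≤ C ∧ 0 < ρ ∧ ρ < 1 ∧ ∀ n, ‖a n‖ ≤ C * ρ ^ n := by
  obtain ⟨S, hS1, hSR⟩ := exists_between hR
  have hS0 : 0 < S := one_pos.trans hS1
  have hs := (h (S : ℂ) (by simpa [abs_of_pos hS0] using hSR)).summable.norm
  refine ⟨∑' n, ‖a n * (S : ℂ) ^ n‖, S⁻¹, tsum_nonneg fun n => norm_nonneg _, by positivity,
    inv_lt_one_of_one_lt₀ hS1, fun n => ?_⟩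
  have := hs.le_tsum n fun j _ => norm_nonneg _
  rw [inv_pow, ← div_eq_mul_inv, le_div_iff₀ (by positivity)]
  simpa [abs_of_pos hS0] using this

lemma tailSum_bounded {ζ s : ℂ} (hζ : ‖ζ‖ = 1) {a : ℕ → ℂ} {C ρ : ℝ} (hC : 0 ≤ C) (hρ : 0 < ρ)
    (hρ1 : ρ < 1) (ha : ∀ n, ‖a n‖ ≤ C * ρ ^ n) (hs : HasSum (fun n => a n * ζ ^ n) s) :
    ∃ M, ∀ n, ‖tailSum ζ a s n‖ ≤ M := by
  have h1 : ∀ n, ‖tail ζ a s n‖ ≤ C * ρ / (1 - ρ) * ρ ^ n := by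
    intro n
    have := dist_le_of_le_geometric_of_tendsto ρ C hρ1 (f := fun N => ∑ l ∈ range N, a l * ζ ^ l)
      (fun N => by
        rw [Finset.sum_range_succ, dist_comm, dist_eq_norm, add_sub_cancel_left, norm_mul, norm_pow, hζ,
          one_pow, mul_one]
        exact ha N) hs.tendsto_sum_nat (n + 1)
    rw [dist_comm, dist_eq_norm] at this
    refine this.trans (le_of_eq ?_)
    ring
  have hg := (summable_geometric_of_lt_one hρ.le hρ1).mul_left (C * ρ / (1 - ρ))
  refine ⟨_, fun n => (norm_sum_le _ _).trans ((Finset.sum_le_sum fun l _ => h1 l).trans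
    (hg.sum_le_tsum (range n) fun l _ => ?_))⟩
  have : 0 < 1 - ρ := by linarith
  positivity

lemma summable_one_div_mul_succ : Summable fun n : ℕ => 1 / ((n + 1) * (n + 2) : ℝ) := by
  refine Summable.of_nonneg_of_le (fun n => by positivity) (fun n => ?_)
    ((summable_nat_add_iff 1).2 (Real.summable_one_div_nat_pow (p := 2).2 one_lt_two))
  push_cast
  refine one_div_le_one_div_of_le (by positivity) ?_
  nlinarith [(n.cast_nonneg : (0 : ℝ) ≤ n)]

lemma weightedSum_bounded {ζ : ℂ} (hζ : ‖ζ‖ = 1) {a : ℕ → ℂ} {C ρ : ℝ} (hC : 0 ≤ C) (hρ : 0 < ρ)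
    (hρ1 : ρ < 1) (ha : ∀ n, ‖a n‖ ≤ C * ρ ^ n) :
    ∃ M, ∀ n, ‖weightedSum ζ a n‖ ≤ M := by
  have hg0 : Summable fun j : ℕ => (j : ℝ) ^ 1 * ρ ^ j :=
    summable_pow_mul_geometric_of_norm_lt_one 1 (by rwa [Real.norm_of_nonneg hρ.le])
  have hg : Summable fun j : ℕ => C * (((j + 1 : ℕ) : ℝ) ^ 1 * ρ ^ (j + 1)) :=
    ((summable_nat_add_iff 1).2 hg0).mul_left C
  refine ⟨_, fun n => (norm_sum_le _ _).trans ((Finset.sum_le_sum fun l _ => ?_).trans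
    (hg.sum_le_tsum (range (n + 1)) fun l _ => by positivity))⟩
  rw [norm_mul, norm_mul, norm_pow, hζ, one_pow, mul_one, Complex.norm_natCast, pow_one]
  calc _ ≤ ((l + 1 : ℕ) : ℝ) * (C * ρ ^ (l + 1)) := by gcongr; exact ha _
    _ = _ := by ring

variable {κ : Type*} [Fintype κ] {ζ : κ → UnitCircle}

lemma memℓp_coords_of_geometric {a : ℕ → ℂ} {C ρ : ℝ} (hC : 0 ≤ C) (hρ : 0 < ρ)
    (hρ1 : ρ < 1) (ha : ∀ n, ‖a n‖ ≤ C * ρ ^ n) : Memℓp (coords ζ a) 2 := by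
  rw [memℓp_coords_iff, summable_prod_of_nonneg (fun j => by positivity)]
  refine ⟨?_, (hasSum_fintype _).summable⟩
  rintro (_ | i)
  · have hg := (summable_geometric_of_lt_one (sq_nonneg ρ) (by nlinarith)).mul_left (C ^ 2)
    refine Summable.of_nonneg_of_le (fun n => by positivity) (fun n => ?_) hg
    calc ‖a n‖ ^ 2 ≤ (C * ρ ^ n) ^ 2 := pow_le_pow_left₀ (norm_nonneg _) (ha n) 2
      _ = _ := by ring
  · obtain ⟨M, hM⟩ := weightedSum_bounded (norm_circle (ζ i)) hC hρ hρ1 ha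
    simp only [norm_coords_some]
    refine Summable.of_nonneg_of_le (fun n => by positivity) (fun n => ?_)
      (summable_one_div_mul_succ.mul_left (M ^ 2))
    rw [mul_one_div]
    gcongr
    exact hM n

/-- With `u = ζ⁻¹ z`, the tails have generating function `(k ζ - k z) / (1 - u)`. Summing them gives
a second factor `1 / (1 - u)`, and the shift by one index gives the factor `u`. -/
lemma hasSum_tailSum {a : ℕ → ℂ} {k : ℂ → ℂ} {R : ℝ} (hR : 1 < R)
    (h : ∀ z : ℂ, ‖z‖ < R → HasSum (fun n => a n * z ^ n) (k z)) (ζ : UnitCircle) {z : ℂ}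
    (hz : ‖z‖ < 1) :
    HasSum (fun n => (ζ : ℂ)⁻¹ ^ n * tailSum ζ a (k ζ) n * z ^ n)
      ((ζ : ℂ)⁻¹ * z * (k ζ - k z) / (1 - (ζ : ℂ)⁻¹ * z) ^ 2) := by
  have hζ := norm_circle ζ
  have hζ0 : (ζ : ℂ) ≠ 0 := norm_ne_zero_iff.1 (by rw [hζ]; exact one_ne_zero)
  set u := (ζ : ℂ)⁻¹ * z with hu
  have hu1 : ‖u‖ < 1 := by simpa [hu, hζ] using hz
  have h1 : HasSum (fun n => a n * (ζ : ℂ) ^ n * u ^ n) (k z) := by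
    refine (h z (hz.trans hR)).congr_fun fun n => ?_
    rw [hu, mul_pow, inv_pow]
    field_simp
  have h2 := ((hasSum_geometric_of_norm_lt_one hu1).mul_left (k ζ)).sub
    (hasSum_partialSum_mul_pow hu1 h1)
  have h3 : HasSum (fun n => tail ζ a (k ζ) n * u ^ n) ((k ζ - k z) / (1 - u)) := by
    have e : (k ζ - k z) / (1 - u) = k ζ * (1 - u)⁻¹ - k z / (1 - u) := by ring
    rw [e]
    refine h2.congr_fun fun n => ?_
    rw [tail]; ring
  have h4 : HasSum (fun n => tailSum ζ a (k ζ) (n + 1) * u ^ (n + 1))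
      (u * (k ζ - k z) / (1 - u) ^ 2) := by
    have e : u * (k ζ - k z) / (1 - u) ^ 2 = u * ((k ζ - k z) / (1 - u) / (1 - u)) := by
      rw [div_div, ← sq]; ring
    rw [e]
    refine ((hasSum_partialSum_mul_pow hu1 h3).mul_left u).congr_fun fun n => ?_
    rw [tailSum, pow_succ]; ring
  -- The term of index 0 vanishes because `tailSum` at 0 is an empty sum.
  have h5 := (hasSum_nat_add_iff' (f := fun n => tailSum ζ a (k ζ) n * u ^ n) 1).1
    (by simpa [tailSum] using h4)
  refine h5.congr_fun fun n => ?_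
  rw [hu, mul_pow]; ring

/-- The coefficients of a function satisfying the functional equation of the reproducing kernel. -/
lemma coeff_add_sum_tailSum {a : ℕ → ℂ} {k : ℂ → ℂ} {R : ℝ} (hR : 1 < R)
    (h : ∀ z : ℂ, ‖z‖ < R → HasSum (fun n => a n * z ^ n) (k z)) {v : ℂ} (hv : ‖v‖ < 1)
    (hk : ∀ z : ℂ, ‖z‖ < 1 → k z + ∑ i, ((ζ i : ℂ)⁻¹ * z * (k (ζ i) - k z) /
      (1 - (ζ i : ℂ)⁻¹ * z) ^ 2) = (1 - v * z)⁻¹) (n : ℕ) :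
    a n + ∑ i, (ζ i : ℂ)⁻¹ ^ n * tailSum (ζ i) a (k (ζ i)) n = v ^ n := by
  refine congrFun (coeff_unique (f := fun z => (1 - v * z)⁻¹)
    (a := fun n => a n + ∑ i, (ζ i : ℂ)⁻¹ ^ n * tailSum (ζ i) a (k (ζ i)) n)
    (b := fun n => v ^ n) one_pos (fun z hz => ?_) fun z hz => ?_) n
  · rw [← hk z hz]
    refine ((h z (hz.trans hR)).add (hasSum_sum fun i _ => hasSum_tailSum hR h (ζ i) hz)).congr_fun
      fun n => ?_
    rw [add_mul, Finset.sum_mul]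
  · have : ‖v * z‖ < 1 := by
      rw [norm_mul]
      exact mul_lt_one_of_nonneg_of_lt_one_left (norm_nonneg v) hv hz.le
    refine (hasSum_geometric_of_norm_lt_one this).congr_fun fun n => (mul_pow _ _ _).symm

lemma tendsto_weightedSum_div {ζ : ℂ} {a : ℕ → ℂ}
    (h : Summable fun n : ℕ => ‖weightedSum ζ a n‖ ^ 2 / ((n + 1) * (n + 2) : ℝ)) :
    Tendsto (fun n : ℕ => weightedSum ζ a n / (n + 2)) atTop (𝓝 0) := by
  rw [tendsto_zero_iff_norm_tendsto_zero]
  have h0 := (h.tendsto_atTop_zero).sqrt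
  rw [Real.sqrt_zero] at h0
  refine squeeze_zero (fun n => norm_nonneg _) (fun n => ?_) h0
  have e : ‖(n : ℂ) + 2‖ = n + 2 := by
    have := Complex.norm_natCast (n + 2); push_cast at this; exact this
  rw [norm_div, e]
  refine Real.le_sqrt_of_sq_le ?_
  rw [div_pow]
  gcongr
  nlinarith [(n.cast_nonneg : (0 : ℝ) ≤ n)]

/-- Summation by parts turns the inner product into `∑ b_n conj (a_n + ∑_i ζ_i⁻¹ ^ n T_n)`, where
`T_n` are the tail sums of `a` at `ζ_i`. The functional equation, read on coefficients, says that
the conjugated factor is `conj w ^ n`. -/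
theorem inner_ofCoeffs {a : ℕ → ℂ} {k : ℂ → ℂ} {R : ℝ} (hR : 1 < R)
    (h : ∀ z : ℂ, ‖z‖ < R → HasSum (fun n => a n * z ^ n) (k z)) {w : ℂ} (hw : ‖w‖ < 1)
    (hk : ∀ z : ℂ, ‖z‖ < 1 → k z + ∑ i, ((ζ i : ℂ)⁻¹ * z * (k (ζ i) - k z) /
      (1 - (ζ i : ℂ)⁻¹ * z) ^ 2) = (1 - conj w * z)⁻¹) (ha : Memℓp (coords ζ a) 2)
    (x : model ζ) :
    inner ℂ (ofCoeffs a ha) x = ∑' n, coeffs x n * w ^ n := by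
  obtain ⟨C, ρ, hC, hρ, hρ1, hbound⟩ := exists_geometric_bound hR h
  set b := coeffs x with hb
  have hcoef := coeff_add_sum_tailSum hR h (by simpa using hw) hk
  have hsum : HasSum (fun j => coords ζ b j * conj (coords ζ a j)) (inner ℂ (ofCoeffs a ha) x) := by
    have := lp.hasSum_inner (𝕜 := ℂ) (ofCoeffs a ha).1 x.1
    refine this.congr_fun fun j => ?_
    rw [RCLike.inner_apply, hb, coords_coeffs]
    rfl
  have hfib := hsum.prod_fiberwise fun o => (hsum.summable.prod_factor o).hasSum
  have htot := (hasSum_fintype _).unique hfib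
  rw [← htot, Fintype.sum_option]
  -- The Hardy part is truncated one index later than the local parts, because the summation by
  -- parts pairs `W_n` with the coefficient of index `n + 1`.
  have hlim : Tendsto (fun N : ℕ => ∑ n ∈ range (N + 2), b n * conj (a n) +
      ∑ i, ∑ n ∈ range (N + 1), coords ζ b (some i, n) * conj (coords ζ a (some i, n))) atTop
      (𝓝 (∑' n, coords ζ b (none, n) * conj (coords ζ a (none, n)) +
        ∑ i, ∑' n, coords ζ b (some i, n) * conj (coords ζ a (some i, n)))) := by
    refine Tendsto.add ?_ (tendsto_finsetSum _ fun i _ => ?_)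
    · exact (tendsto_add_atTop_iff_nat 2).2 (hsum.summable.prod_factor none).hasSum.tendsto_sum_nat
    · exact (tendsto_add_atTop_iff_nat 1).2
        (hsum.summable.prod_factor (some i)).hasSum.tendsto_sum_nat
  have hfin : ∀ N : ℕ, ∑ n ∈ range (N + 2), b n * conj (a n) +
      ∑ i, ∑ n ∈ range (N + 1), coords ζ b (some i, n) * conj (coords ζ a (some i, n)) =
      ∑ n ∈ range (N + 2), b n * w ^ n -
        ∑ i, weightedSum (ζ i) b N / (N + 2) * conj (tailSum (ζ i) a (k (ζ i)) (N + 2)) := by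
    intro N
    have e1 : ∀ i, ∑ n ∈ range (N + 1), coords ζ b (some i, n) * conj (coords ζ a (some i, n)) =
        ∑ n ∈ range (N + 2), b n * (ζ i : ℂ) ^ n * conj (tailSum (ζ i) a (k (ζ i)) n) -
          weightedSum (ζ i) b N / (N + 2) * conj (tailSum (ζ i) a (k (ζ i)) (N + 2)) := by
      intro i
      rw [Finset.sum_range_succ' _ (N + 1), div_mul_eq_mul_div]
      have := sum_weightedSum_mul_conj (ζ i) b a (k (ζ i)) N
      simp only [tailSum, Finset.range_zero, Finset.sum_empty, map_zero, mul_zero, add_zero] at this ⊢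
      rw [← this]
      refine Finset.sum_congr rfl fun n _ => ?_
      simp only [coords, map_div₀, Complex.conj_ofReal]
      rw [div_mul_div_comm, ← Complex.ofReal_mul, Real.mul_self_sqrt (by positivity)]
      push_cast
      rfl
    simp_rw [e1]
    rw [Finset.sum_sub_distrib, Finset.sum_comm, ← add_sub_assoc, ← Finset.sum_add_distrib]
    congr 1
    refine Finset.sum_congr rfl fun n _ => ?_
    have := congrArg conj (hcoef n)
    rw [map_add, map_sum, map_pow, Complex.conj_conj] at this
    rw [← this, mul_add, Finset.mul_sum]
    congr 1
    refine Finset.sum_congr rfl fun i _ => ?_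
    have hζc : conj ((ζ i : ℂ)⁻¹) = ζ i := by
      rw [Complex.inv_def, Complex.normSq_eq_norm_sq, norm_circle]
      simp
    rw [map_mul, map_pow, hζc]
    ring
  simp_rw [hfin] at hlim
  refine tendsto_nhds_unique hlim ?_
  rw [← sub_zero (∑' n, b n * w ^ n)]
  refine Tendsto.sub ((tendsto_add_atTop_iff_nat 2).2 (summable_coeffs x hw).hasSum.tendsto_sum_nat) ?_
  -- The boundary term vanishes: `W_N / (N + 2)` tends to 0 since the local Dirichlet series
  -- converges, and the tail sums are bounded since `k` is analytic past the closed disc.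
  suffices hi : ∀ i, Tendsto (fun N : ℕ => weightedSum (ζ i) b N / (N + 2) *
      conj (tailSum (ζ i) a (k (ζ i)) (N + 2))) atTop (𝓝 0) by
    have := tendsto_finsetSum (Finset.univ : Finset κ) fun i _ => hi i
    rwa [Finset.sum_const_zero] at this
  intro i
  obtain ⟨M, hM⟩ := tailSum_bounded (norm_circle (ζ i)) hC hρ hρ1 hbound
    (h (ζ i) (by rw [norm_circle]; exact hR))
  refine Tendsto.zero_mul_isBoundedUnder_le (tendsto_weightedSum_div ?_) ?_
  · have := (memℓp_coords_iff ζ b).1 (by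
      have := x.1.2
      rwa [show (x.1 : Option κ × ℕ → ℂ) = coords ζ b from funext fun j => (coords_coeffs x j).symm]
        at this)
    have := this.prod_factor (some i)
    simpa only [norm_coords_some] using this
  · refine isBoundedUnder_of ⟨M, fun n => ?_⟩
    simpa using hM _

end DirichletDBR

namespace DirichletDBR
open Filter Topology Finset MeasureTheory ComplexConjugate

/-! ### Reproducing kernel Hilbert spaces with the same kernel -/

section Uniqueness

variable {𝕜 X V H₁ H₂ : Type*} [RCLike 𝕜] [NormedAddCommGroup V] [InnerProductSpace 𝕜 V]
  [CompleteSpace V] [NormedAddCommGroup H₁] [InnerProductSpace 𝕜 H₁] [CompleteSpace H₁]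
  [NormedAddCommGroup H₂] [InnerProductSpace 𝕜 H₂] [CompleteSpace H₂]
  [RKHS 𝕜 H₁ X V] [RKHS 𝕜 H₂ X V]

lemma norm_linearCombination_kerFun (hK : RKHS.kernel H₁ = RKHS.kernel H₂) (u : X × V →₀ 𝕜) :
    ‖Finsupp.linearCombination 𝕜 (fun p : X × V => RKHS.kerFun H₁ p.1 p.2) u‖ =
      ‖Finsupp.linearCombination 𝕜 (fun p : X × V => RKHS.kerFun H₂ p.1 p.2) u‖ := by
  have h : ∀ p q : X × V, inner 𝕜 (RKHS.kerFun H₁ p.1 p.2) (RKHS.kerFun H₁ q.1 q.2) =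
      inner 𝕜 (RKHS.kerFun H₂ p.1 p.2) (RKHS.kerFun H₂ q.1 q.2) := fun p q => by
    rw [← RKHS.kernel_inner, ← RKHS.kernel_inner, hK]
  rw [← sq_eq_sq₀ (norm_nonneg _) (norm_nonneg _), ← inner_self_eq_norm_sq (𝕜 := 𝕜),
    ← inner_self_eq_norm_sq (𝕜 := 𝕜)]
  simp only [Finsupp.linearCombination_apply, Finsupp.sum, sum_inner, inner_sum, inner_smul_left,
    inner_smul_right, h]

/-- A reproducing kernel Hilbert space is determined by its kernel. -/
theorem exists_of_kernel_eq (hK : RKHS.kernel H₁ = RKHS.kernel H₂) (f : H₁) :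
    ∃ g : H₂, (⇑g : X → V) = ⇑f ∧ ‖g‖ = ‖f‖ := by
  set Φ₁ := Finsupp.linearCombination 𝕜 (fun p : X × V => RKHS.kerFun H₁ p.1 p.2)
  set Φ₂ := Finsupp.linearCombination 𝕜 (fun p : X × V => RKHS.kerFun H₂ p.1 p.2)
  -- Finite combinations of kernel functions are dense, and their norms and values depend only on
  -- the kernel; so an approximating sequence for `f` can be copied into `H₂`.
  have hf : f ∈ closure (Set.range Φ₁) := by
    have h : f ∈ (Submodule.span 𝕜 {RKHS.kerFun H₁ x v | (x) (v)}).topologicalClosure := by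
      rw [RKHS.kerFun_dense]; trivial
    have e : {RKHS.kerFun H₁ x v | (x) (v)} =
        Set.range fun p : X × V => RKHS.kerFun H₁ p.1 p.2 := by
      ext y; simp
    rw [e, ← Finsupp.range_linearCombination] at h
    exact h
  obtain ⟨y, hy, hlim⟩ := mem_closure_iff_seq_limit.1 hf
  choose u hu using hy
  have hnorm : ∀ n m, ‖Φ₂ (u n) - Φ₂ (u m)‖ = ‖y n - y m‖ := fun n m => by
    rw [← map_sub, ← norm_linearCombination_kerFun hK, map_sub]
    simp only [Φ₁, ← hu]
  have hcau : CauchySeq fun n => Φ₂ (u n) := by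
    refine Metric.cauchySeq_iff'.2 fun ε hε => ?_
    obtain ⟨N, hN⟩ := Metric.cauchySeq_iff'.1 hlim.cauchySeq ε hε
    refine ⟨N, fun n hn => ?_⟩
    rw [dist_eq_norm, hnorm, ← dist_eq_norm]
    exact hN n hn
  obtain ⟨g, hg⟩ := cauchySeq_tendsto_of_complete hcau
  refine ⟨g, ?_, ?_⟩
  · funext x
    refine ext_inner_left 𝕜 fun v => ?_
    rw [← RKHS.kerFun_inner, ← RKHS.kerFun_inner]
    refine tendsto_nhds_unique (Tendsto.inner (𝕜 := 𝕜) tendsto_const_nhds hg) ?_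
    have h1 := Tendsto.inner (𝕜 := 𝕜) (tendsto_const_nhds (x := RKHS.kerFun H₁ x v)) hlim
    refine h1.congr fun n => ?_
    rw [← hu]
    simp only [Φ₁, Φ₂, Finsupp.linearCombination_apply, Finsupp.sum, inner_sum, inner_smul_right,
      ← RKHS.kernel_inner, hK]
  · refine tendsto_nhds_unique hg.norm (hlim.norm.congr fun n => ?_)
    rw [← hu]
    exact norm_linearCombination_kerFun hK _

end Uniqueness

/-! ### The model as a reproducing kernel Hilbert space -/

variable {κ : Type*} {ζ : κ → UnitCircle}

lemma hasSum_coeffs_of_reproducing {e : 𝔻 → model ζ}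
    (he : ∀ w x, inner ℂ (e w) x = ∑' n, coeffs x n * (w : ℂ) ^ n) (x : model ζ) (w : 𝔻) :
    HasSum (fun n => coeffs x n * (w : ℂ) ^ n) (inner ℂ (e w) x) := by
  rw [he]
  exact (summable_coeffs x w.norm_lt_one).hasSum

lemma eq_of_coeffs_eq {x y : model ζ} (h : coeffs x = coeffs y) : x = y := by
  refine Subtype.ext (lp.ext (funext fun j => ?_))
  rw [← coords_coeffs, ← coords_coeffs, h]

/-- The model is a reproducing kernel Hilbert space, with kernel functions `e w`. -/
@[reducible]
noncomputable def modelRKHS (e : 𝔻 → model ζ)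
    (he : ∀ w x, inner ℂ (e w) x = ∑' n, coeffs x n * (w : ℂ) ^ n) : RKHS ℂ (model ζ) 𝔻 ℂ where
  coeCLM := ContinuousLinearMap.pi fun w => innerSL ℂ (e w)
  coeCLM_injective := by
    intro x y hxy
    refine eq_of_coeffs_eq ?_
    have hx := holomorphic_of_hasSum (hasSum_coeffs_of_reproducing he x)
    have hy := holomorphic_of_hasSum (hasSum_coeffs_of_reproducing he y)
    have : (fun w => inner ℂ (e w) x) = fun w => inner ℂ (e w) y := hxy
    rw [← hx.2, ← hy.2, this]

/-- If `K(·, w)` reproduces the values at `w` in the model, then the reproducing kernel Hilbert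
space with kernel `K` is the Dirichlet-type space, with equal norms. -/
theorem range_ofKernel_eq_dirichletSpace [Fintype κ] [Nonempty κ] (e : 𝔻 → model ζ)
    (he : ∀ w x, inner ℂ (e w) x = ∑' n, coeffs x n * (w : ℂ) ^ n)
    {K : Matrix 𝔻 𝔻 (ℂ →L[ℂ] ℂ)} (hK : ∀ z w, K z w 1 = inner ℂ (e z) (e w)) :
    ∃ _ : Fact K.PosSemidef,
      Set.range (fun h : RKHS.OfKernel K => (h : 𝔻 → ℂ)) =
          dirichletSpace (∑ i, Measure.dirac (ζ i)) ∧
        ∀ h : RKHS.OfKernel K,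
          dirichletNormSq (∑ i, Measure.dirac (ζ i)) (h : 𝔻 → ℂ) = ENNReal.ofReal (‖h‖ ^ 2) := by
  let _ := modelRKHS e he
  have happ : ∀ (x : model ζ) (w : 𝔻), x w = inner ℂ (e w) x := fun x w => rfl
  have hker : RKHS.kernel (model ζ) = K := by
    ext z w
    have h1 : RKHS.kerFun (model ζ) w 1 = e w := by
      refine ext_inner_right ℂ fun x => ?_
      rw [RKHS.kerFun_inner, happ]
      simp
    rw [← RKHS.kerFun_apply, h1, happ, hK]
  -- Positivity of `K` needs no separate argument: `K` is the kernel of the model.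
  have hpos : K.PosSemidef := hker ▸ RKHS.posSemidef_kernel (model ζ)
  have hfact : Fact K.PosSemidef := ⟨hpos⟩
  have hker' : RKHS.kernel (model ζ) = RKHS.kernel (RKHS.OfKernel K) := by
    rw [hker, RKHS.OfKernel.kernel_ofKernel]
  have hfun : ∀ x : model ζ, Holomorphic (x : 𝔻 → ℂ) ∧ taylorCoeff (x : 𝔻 → ℂ) = coeffs x :=
    fun x => holomorphic_of_hasSum (hasSum_coeffs_of_reproducing he x)
  have hnorm : ∀ x : model ζ, dirichletNormSq (∑ i, Measure.dirac (ζ i)) (x : 𝔻 → ℂ) =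
      ENNReal.ofReal (‖x‖ ^ 2) := fun x => by
    rw [dirichletNormSq_eq ζ (hfun x).1, (hfun x).2, ofReal_norm_sq]
  refine ⟨hfact, ?_, ?_⟩
  · ext f
    constructor
    · rintro ⟨h, rfl⟩
      obtain ⟨x, hx, -⟩ := exists_of_kernel_eq hker'.symm h
      simp only
      rw [← hx]
      refine ⟨(hfun x).1, lt_of_le_of_lt le_add_self (b := dirichletNormSq _ _) ?_⟩
      rw [hnorm]
      exact ENNReal.ofReal_lt_top
    · intro hf
      have hmem := memℓp_of_mem_dirichletSpace ζ hf
      obtain ⟨h, hh, -⟩ := exists_of_kernel_eq hker' (ofCoeffs (taylorCoeff f) hmem)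
      refine ⟨h, ?_⟩
      simp only
      rw [hh]
      funext z
      have h1 := hasSum_taylorCoeff hf.1 z.norm_lt_one
      rw [extendZero_coe] at h1
      rw [happ]
      exact (hasSum_coeffs_of_reproducing he _ z).unique h1
  · intro h
    obtain ⟨x, hx, hxn⟩ := exists_of_kernel_eq hker'.symm h
    rw [← hx, hnorm, hxn]

end DirichletDBR

namespace DirichletDBR
open Filter Topology Finset MeasureTheory ComplexConjugate

/-! ### The kernel of the two-point space -/

/-- The denominator `q`, in terms of `s = x + y` and `m = x² + y²`. -/
noncomputable def den (s m z : ℂ) : ℂ := z ^ 2 - s * (1 + Complex.I) * z + Complex.I * m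

/-- The polynomial with conjugate coefficients of `den`. -/
noncomputable def denConj (s m z : ℂ) : ℂ := z ^ 2 - s * (1 - Complex.I) * z - Complex.I * m

/-- The reciprocal polynomial of `den`. -/
noncomputable def denRev (s m z : ℂ) : ℂ := 1 - s * (1 - Complex.I) * z - Complex.I * m * z ^ 2

/-- The numerator `p₁`. -/
noncomputable def num₁ (c r z : ℂ) : ℂ := c * z + (-r + r * Complex.I) * z ^ 2

/-- The polynomial with conjugate coefficients of `num₁`. -/
noncomputable def num₁Conj (c r z : ℂ) : ℂ := c * z + (-r - r * Complex.I) * z ^ 2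

/-- The remainder in the factorisation of the numerator of the kernel. -/
noncomputable def kerRem (s m c r d v z : ℂ) : ℂ :=
  (c + (-r + r * Complex.I) * z) * ((-r - r * Complex.I) *
    (s * (1 - Complex.I) * v + Complex.I * m * (1 + v * z)) + c * (v + Complex.I * m * z)) +
    d ^ 2 * z * (s * (1 - Complex.I) * v + Complex.I * m * (1 + v * z))

/-- The numerator of the kernel. -/
noncomputable def kerNum (s m c r d v z : ℂ) : ℂ :=
  den s m z * denConj s m v - num₁ c r z * num₁Conj c r v - d ^ 2 * z ^ 2 * v ^ 2

/-! ### Polynomial identities for the numerator, the denominator and the kernel. -/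

section Algebra

variable {s m c r d : ℂ}

/-- The spectral factorisation of `|q|²`, continued from the circle to the plane: there `denRev = z²
conj q`, `|z - 1|² = -(z - 1)² / z` and `|z - i|² = i (z - i)² / z`. -/
lemma I_mul_den_mul_denRev (h1 : s * (1 + m) = 3 * m) (h2 : 1 + 2 * s ^ 2 + m ^ 2 = 8 * m)
    (z : ℂ) : Complex.I * (den s m z * denRev s m z) =
      m * ((z - 1) ^ 2 * (z - Complex.I) ^ 2 - z * (z - Complex.I) ^ 2 -
        Complex.I * z * (z - 1) ^ 2) := by
  have hI := Complex.I_sq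
  rw [den, denRev]
  grind

/-- On the circle with `v = conj z` this reduces to `|q|² - |p₁|² - |p₂|² = m |z - 1|² |z - i|²`;
`kerRem` is the quotient of the difference by `z (1 - v z)`. The first term on the right vanishes at
`z = 1` and `z = i`. -/
lemma kerNum_mul_denRev (h1 : s * (1 + m) = 3 * m) (h2 : 1 + 2 * s ^ 2 + m ^ 2 = 8 * m)
    (h3 : c * r = m) (h4 : c ^ 2 + 2 * r ^ 2 + d ^ 2 = 4 * m) (v z : ℂ) :
    kerNum s m c r d v z * denRev s m z =
      -Complex.I * m * ((z - 1) * (z - Complex.I)) ^ 2 * denConj s m v -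
        z * (1 - v * z) * kerRem s m c r d v z := by
  have hI := Complex.I_sq
  rw [kerNum, den, denRev, denConj, kerRem, num₁, num₁Conj]
  grind

/-- As a polynomial of degree at most 2 in `z`, `kerRem` lies in the span of `(z - 1)²` and `(z -
i)²`, with coefficients read off at `i` and `1`. This membership is a nontrivial linear condition on
a quadratic, and `h5` is the relation that secures it. -/
lemma kerRem_interpolation (h1 : s * (1 + m) = 3 * m) (h2 : 1 + 2 * s ^ 2 + m ^ 2 = 8 * m)
    (h3 : c * r = m) (h4 : c ^ 2 + 2 * r ^ 2 + d ^ 2 = 4 * m)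
    (h5 : c ^ 2 * (m - s + 1) = m * (3 * m - 2 * s + 1)) (v z : ℂ) :
    2 * Complex.I * kerRem s m c r d v z =
      Complex.I * (z - 1) ^ 2 * (Complex.I * kerRem s m c r d v Complex.I) -
        (z - Complex.I) ^ 2 * kerRem s m c r d v 1 := by
  have hI := Complex.I_sq
  rw [kerRem, kerRem, kerRem]
  grind

lemma kernel_functional_equation (h1 : s * (1 + m) = 3 * m)
    (h2 : 1 + 2 * s ^ 2 + m ^ 2 = 8 * m)
    (h3 : c * r = m) (h4 : c ^ 2 + 2 * r ^ 2 + d ^ 2 = 4 * m)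
    (h5 : c ^ 2 * (m - s + 1) = m * (3 * m - 2 * s + 1)) {v z : ℂ} {k : ℂ → ℂ}
    (hk : ∀ z, k z = kerNum s m c r d v z / (den s m z * denConj s m v) / (1 - v * z))
    (hm : m ≠ 0) (hq : den s m z ≠ 0) (hq1 : den s m 1 ≠ 0) (hqI : den s m Complex.I ≠ 0)
    (hqv : denConj s m v ≠ 0) (hv : 1 - v * z ≠ 0) (hv1 : 1 - v ≠ 0)
    (hvI : 1 - v * Complex.I ≠ 0) (hz1 : 1 - z ≠ 0) (hzI : 1 + Complex.I * z ≠ 0) :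
    k z + ((1 : ℂ)⁻¹ * z * (k 1 - k z) / (1 - (1 : ℂ)⁻¹ * z) ^ 2 +
      Complex.I⁻¹ * z * (k Complex.I - k z) / (1 - Complex.I⁻¹ * z) ^ 2) = (1 - v * z)⁻¹ := by
  have hI := Complex.I_sq
  have e1 : den s m 1 * denRev s m 1 = 2 * m := by
    have := I_mul_den_mul_denRev h1 h2 1
    refine mul_left_cancel₀ Complex.I_ne_zero (this.trans ?_)
    linear_combination (-m) * hI
  have eI : den s m Complex.I * denRev s m Complex.I = -2 * m := by
    have := I_mul_den_mul_denRev h1 h2 Complex.I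
    refine mul_left_cancel₀ Complex.I_ne_zero (this.trans ?_)
    linear_combination (2 * m * Complex.I - m * Complex.I ^ 2) * hI
  have hX : k z * (den s m z * denConj s m v * (1 - v * z)) = kerNum s m c r d v z := by
    rw [hk]; field_simp
  have hX1 : k 1 * (den s m 1 * denConj s m v * (1 - v)) = kerNum s m c r d v 1 := by
    rw [hk, mul_one]; field_simp
  have hXI : k Complex.I * (den s m Complex.I * denConj s m v * (1 - v * Complex.I)) =
      kerNum s m c r d v Complex.I := by
    rw [hk]; field_simp
  -- At the two boundary points only the `kerRem` term of `kerNum_mul_denRev` survives, so `k 1` and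
  -- `k i` are multiples of its values there.
  have hA : k 1 * (2 * m * denConj s m v) = -kerRem s m c r d v 1 := by
    have := kerNum_mul_denRev h1 h2 h3 h4 v 1
    refine mul_left_cancel₀ hv1 ?_
    linear_combination this + denRev s m 1 * hX1 - k 1 * denConj s m v * (1 - v) * e1
  have hB : k Complex.I * (2 * m * denConj s m v) = Complex.I * kerRem s m c r d v Complex.I := by
    have := kerNum_mul_denRev h1 h2 h3 h4 v Complex.I
    refine mul_left_cancel₀ hvI ?_
    linear_combination -this - denRev s m Complex.I * hXI +
      k Complex.I * denConj s m v * (1 - v * Complex.I) * eI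
  -- The functional equation multiplied by `(z - 1)² (z - i)² (1 - v z)`. The polynomial multiplying
  -- `k z` is the one factored in `I_mul_den_mul_denRev`.
  have hmain : (k z * ((z - 1) ^ 2 * (z - Complex.I) ^ 2 - z * (z - Complex.I) ^ 2 -
      Complex.I * z * (z - 1) ^ 2) + z * (z - Complex.I) ^ 2 * k 1 +
      Complex.I * z * (z - 1) ^ 2 * k Complex.I) * (1 - v * z) =
      ((z - 1) * (z - Complex.I)) ^ 2 := by
    have h := kerNum_mul_denRev h1 h2 h3 h4 v z
    have hG := kerRem_interpolation h1 h2 h3 h4 h5 v z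
    have hW := I_mul_den_mul_denRev h1 h2 z
    refine mul_left_cancel₀ (mul_ne_zero (mul_ne_zero two_ne_zero hm) hqv) ?_
    linear_combination (-2 * denConj s m v * (1 - v * z) * k z) * hW +
      2 * Complex.I * denRev s m z * hX + 2 * Complex.I * h +
      (1 - v * z) * z * (z - Complex.I) ^ 2 * hA +
      (1 - v * z) * z * Complex.I * (z - 1) ^ 2 * hB - (1 - v * z) * z * hG -
      2 * m * ((z - 1) * (z - Complex.I)) ^ 2 * denConj s m v * hI
  have hz1' : z - 1 ≠ 0 := by rw [← neg_sub, neg_ne_zero]; exact hz1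
  have e2 : 1 + Complex.I * z = Complex.I * (z - Complex.I) := by linear_combination hI
  have hzI' : z - Complex.I ≠ 0 := fun h => hzI (by rw [e2, h, mul_zero])
  rw [Complex.inv_I, inv_one, one_mul, show 1 - -Complex.I * z = Complex.I * (z - Complex.I) by
    rw [← e2]; ring, mul_pow, hI, show (1 - z) ^ 2 = (z - 1) ^ 2 by ring]
  rw [← one_div, eq_div_iff hv]
  field_simp
  linear_combination hmain

end Algebra

end DirichletDBR

namespace DirichletDBR
open Filter Topology Finset MeasureTheory ComplexConjugate

/-! ### Row symbols -/

lemma row_apply (b : Fin 2 → 𝔻 → ℂ) (z : 𝔻) (u : EuclideanSpace ℂ (Fin 2)) :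
    row b z u = ∑ j, b j z * u j := by
  simp [row]

lemma row_adjoint_row (b : Fin 2 → 𝔻 → ℂ) (z w : 𝔻) :
    row b z (ContinuousLinearMap.adjoint (row b w) 1) = ∑ j, b j z * conj (b j w) := by
  have h : ∀ j, ContinuousLinearMap.adjoint (row b w) 1 j = conj (b j w) := by
    intro j
    have := ContinuousLinearMap.adjoint_inner_right (row b w) (EuclideanSpace.single j (1 : ℂ)) 1
    rw [EuclideanSpace.inner_single_left, row_apply] at this
    simpa using this
  rw [row_apply]
  simp_rw [h]

lemma dBRKernel_row_apply_one (b : Fin 2 → 𝔻 → ℂ) (z w : 𝔻) :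
    dBRKernel (row b) z w 1 =
      (1 - ∑ j, b j z * conj (b j w)) / (1 - conj (w : ℂ) * z) := by
  rw [dBRKernel, Matrix.of_apply, smul_apply, sub_apply,
    ContinuousLinearMap.comp_apply, row_adjoint_row, smul_eq_mul, ContinuousLinearMap.id_apply,
    mul_comm (z : ℂ)]
  ring

lemma norm_row_le_one {b : Fin 2 → 𝔻 → ℂ} {z : 𝔻} (h : ∑ j, ‖b j z‖ ^ 2 ≤ 1) :
    ‖row b z‖ ≤ 1 := by
  refine ContinuousLinearMap.opNorm_le_bound _ zero_le_one fun u => ?_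
  rw [one_mul, row_apply, EuclideanSpace.norm_eq]
  refine Real.le_sqrt_of_sq_le ?_
  calc ‖∑ j, b j z * u j‖ ^ 2 ≤ (∑ j, ‖b j z‖ * ‖u j‖) ^ 2 := by
        gcongr
        exact (norm_sum_le _ _).trans (Finset.sum_le_sum fun j _ => norm_mul_le _ _)
    _ ≤ (∑ j, ‖b j z‖ ^ 2) * ∑ j, ‖u j‖ ^ 2 := Finset.sum_mul_sq_le_sq_mul_sq _ _ _
    _ ≤ 1 * ∑ j, ‖u j‖ ^ 2 := by gcongr
    _ = _ := one_mul _

/-! ### The two-point space -/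

/-- The algebraic relations between the real parameters. -/
structure Admissible (x y c r d : ℝ) : Prop where
  trace : (x + y) * (1 + (x ^ 2 + y ^ 2)) = 3 * (x ^ 2 + y ^ 2)
  norm : 1 + 2 * (x + y) ^ 2 + (x ^ 2 + y ^ 2) ^ 2 = 8 * (x ^ 2 + y ^ 2)
  cross : c * r = x ^ 2 + y ^ 2
  mass : c ^ 2 + 2 * r ^ 2 + d ^ 2 = 4 * (x ^ 2 + y ^ 2)
  lead : c ^ 2 * (x ^ 2 + y ^ 2 - (x + y) + 1) =
    (x ^ 2 + y ^ 2) * (3 * (x ^ 2 + y ^ 2) - 2 * (x + y) + 1)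
  four_lt : 4 < x ^ 2 + y ^ 2

/-- The two boundary points. -/
def twoPoints : Fin 2 → UnitCircle := ![circleOne, circleI]

lemma twoPoint_eq : twoPoint = ∑ i, Measure.dirac (twoPoints i) := by
  simp [twoPoint, twoPoints, Fin.sum_univ_two]

section

variable {x y c r d : ℝ}

lemma den_eq_mul (x y : ℝ) (z : ℂ) :
    den ((x + y : ℝ) : ℂ) ((x ^ 2 + y ^ 2 : ℝ) : ℂ) z =
      (z - (x + Complex.I * y)) * (z - (y + Complex.I * x)) := by
  rw [den]
  push_cast
  linear_combination (-(x : ℂ) * y) * Complex.I_sq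

lemma den_ne_zero (h : 4 < x ^ 2 + y ^ 2) {z : ℂ} (hz : ‖z‖ ≤ 2) :
    den ((x + y : ℝ) : ℂ) ((x ^ 2 + y ^ 2 : ℝ) : ℂ) z ≠ 0 := by
  have hlarge : ∀ s t : ℝ, 4 < s ^ 2 + t ^ 2 → z - (s + Complex.I * t) ≠ 0 := by
    intro s t hst h0
    rw [sub_eq_zero.1 h0] at hz
    have h2 : ‖(s : ℂ) + Complex.I * t‖ ^ 2 = s ^ 2 + t ^ 2 := by
      rw [← Complex.normSq_eq_norm_sq, mul_comm, Complex.normSq_add_mul_I]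
    nlinarith [norm_nonneg ((s : ℂ) + Complex.I * t)]
  rw [den_eq_mul]
  exact mul_ne_zero (hlarge x y h) (hlarge y x (by linarith))

lemma differentiable_den (s m : ℂ) : Differentiable ℂ (den s m) := by
  unfold den
  fun_prop

lemma denConj_conj (s m : ℝ) (w : ℂ) : denConj s m (conj w) = conj (den s m w) := by
  simp only [denConj, den, map_add, map_sub, map_mul, map_pow, map_one, Complex.conj_I,
    Complex.conj_ofReal]
  ring

lemma num₁Conj_conj (c r : ℝ) (w : ℂ) : num₁Conj c r (conj w) = conj (num₁ c r w) := by
  simp only [num₁Conj, num₁, map_add, map_neg, map_mul, map_pow, Complex.conj_I,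
    Complex.conj_ofReal]
  ring

/-- The reproducing kernel of the two-point space, as a function of `z` for `v = conj w`. -/
noncomputable def kerFn (x y c r d : ℝ) (v z : ℂ) : ℂ :=
  kerNum ((x + y : ℝ) : ℂ) ((x ^ 2 + y ^ 2 : ℝ) : ℂ) c r d v z /
    (den ((x + y : ℝ) : ℂ) ((x ^ 2 + y ^ 2 : ℝ) : ℂ) z *
      denConj ((x + y : ℝ) : ℂ) ((x ^ 2 + y ^ 2 : ℝ) : ℂ) v) / (1 - v * z)

lemma one_sub_ne_zero_of_norm_lt {u : ℂ} (h : ‖u‖ < 1) : 1 - u ≠ 0 := by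
  intro h0
  rw [← sub_eq_zero.1 h0, norm_one] at h
  exact lt_irrefl _ h

lemma kerFn_functional_equation (hp : Admissible x y c r d) {w z : ℂ} (hw : ‖w‖ < 1)
    (hz : ‖z‖ < 1) :
    kerFn x y c r d (conj w) z + ∑ i, ((twoPoints i : ℂ)⁻¹ * z *
      (kerFn x y c r d (conj w) (twoPoints i) - kerFn x y c r d (conj w) z) /
      (1 - (twoPoints i : ℂ)⁻¹ * z) ^ 2) = (1 - conj w * z)⁻¹ := by
  have hw' : ‖conj w‖ < 1 := by simpa using hw
  rw [Fin.sum_univ_two]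
  refine kernel_functional_equation (k := kerFn x y c r d (conj w))
    (by exact_mod_cast hp.trace) (by exact_mod_cast hp.norm) (by exact_mod_cast hp.cross)
    (by exact_mod_cast hp.mass) (by exact_mod_cast hp.lead) (fun z => rfl)
    (by exact_mod_cast (by linarith [hp.four_lt] : x ^ 2 + y ^ 2 ≠ 0))
    (den_ne_zero hp.four_lt (by linarith)) (den_ne_zero hp.four_lt (by simp))
    (den_ne_zero hp.four_lt (by simp)) ?_
    (one_sub_ne_zero_of_norm_lt ?_) (one_sub_ne_zero_of_norm_lt hw')
    (one_sub_ne_zero_of_norm_lt (by simpa using hw)) (one_sub_ne_zero_of_norm_lt hz) ?_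
  · rw [denConj_conj]
    exact (map_ne_zero _).2 (den_ne_zero hp.four_lt (by linarith))
  · rw [norm_mul]
    exact mul_lt_one_of_nonneg_of_lt_one_left (norm_nonneg _) hw' hz.le
  · have := one_sub_ne_zero_of_norm_lt (u := -(Complex.I * z)) (by simpa using hz)
    rwa [sub_neg_eq_add] at this

/-- The singularities are the zeros of `den`, of modulus greater than 2, and `1 / conj w`. The
radius `2 / (1 + ‖w‖)` is at most 2 and at most `1 / ‖w‖`, yet exceeds 1. -/
lemma differentiableOn_kerFn (hp : Admissible x y c r d) {w : ℂ} (hw : ‖w‖ < 1) :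
    DifferentiableOn ℂ (kerFn x y c r d (conj w)) (Metric.ball 0 (2 / (1 + ‖w‖))) := by
  have hw0 := norm_nonneg w
  intro z hz
  have hz' : ‖z‖ < 2 / (1 + ‖w‖) := by simpa using hz
  rw [lt_div_iff₀ (by positivity)] at hz'
  have hz0 := norm_nonneg z
  have hz2 : ‖z‖ ≤ 2 := by nlinarith
  have hwz : ‖conj w * z‖ < 1 := by
    rw [norm_mul, RCLike.norm_conj]
    nlinarith
  refine DifferentiableAt.differentiableWithinAt ?_
  unfold kerFn
  refine DifferentiableAt.div (DifferentiableAt.div ?_ ?_ (mul_ne_zero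
    (den_ne_zero hp.four_lt hz2) ?_)) ?_ (one_sub_ne_zero_of_norm_lt hwz)
  · have := differentiable_den ((x + y : ℝ) : ℂ) ((x ^ 2 + y ^ 2 : ℝ) : ℂ)
    unfold kerNum num₁
    fun_prop
  · exact (differentiable_den _ _ z).mul (differentiableAt_const _)
  · rw [denConj_conj]
    exact (map_ne_zero _).2 (den_ne_zero hp.four_lt (by linarith))
  · fun_prop

theorem exists_kernel_elements (hp : Admissible x y c r d) :
    ∃ e : 𝔻 → model twoPoints,
      (∀ w x, inner ℂ (e w) x = ∑' n, coeffs x n * (w : ℂ) ^ n) ∧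
        ∀ z w : 𝔻, inner ℂ (e z) (e w) = kerFn x y c r d (conj (w : ℂ)) z := by
  have hR : ∀ w : 𝔻, 1 < 2 / (1 + ‖(w : ℂ)‖) := fun w => by
    have h0 := norm_nonneg (w : ℂ)
    rw [lt_div_iff₀ (by positivity)]
    linarith [w.norm_lt_one]
  have hsum := fun (w : 𝔻) (z : ℂ) (hz : ‖z‖ < 2 / (1 + ‖(w : ℂ)‖)) =>
    hasSum_taylor (differentiableOn_kerFn hp w.norm_lt_one) hz
  have hmem : ∀ w : 𝔻, Memℓp (coords twoPoints fun n =>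
      iteratedDeriv n (kerFn x y c r d (conj (w : ℂ))) 0 / (n.factorial : ℂ)) 2 := fun w => by
    obtain ⟨C, ρ, hC, hρ, hρ1, hb⟩ := exists_geometric_bound (hR w) (hsum w)
    exact memℓp_coords_of_geometric hC hρ hρ1 hb
  have hrep := fun (w : 𝔻) (x : model twoPoints) => inner_ofCoeffs (hR w) (hsum w) w.norm_lt_one
    (fun z hz => kerFn_functional_equation hp w.norm_lt_one hz) (hmem w) x
  refine ⟨fun w => ofCoeffs _ (hmem w), hrep, fun z w => ?_⟩
  rw [hrep, coeffs_ofCoeffs]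
  exact (hsum w z (z.norm_lt_one.trans (hR w))).tsum_eq

lemma dBRKernel_row_eq_kerFn (hp : Admissible x y c r d) {b : Fin 2 → 𝔻 → ℂ}
    (h0 : ∀ z, b 0 z = num₁ c r z / den ((x + y : ℝ) : ℂ) ((x ^ 2 + y ^ 2 : ℝ) : ℂ) z)
    (h1 : ∀ z : 𝔻, b 1 z = d * (z : ℂ) ^ 2 /
      den ((x + y : ℝ) : ℂ) ((x ^ 2 + y ^ 2 : ℝ) : ℂ) z) (z w : 𝔻) :
    dBRKernel (row b) z w 1 = kerFn x y c r d (conj (w : ℂ)) z := by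
  rw [dBRKernel_row_apply_one, kerFn, Fin.sum_univ_two, h0, h0, h1, h1, kerNum, denConj_conj,
    num₁Conj_conj]
  have hz := den_ne_zero hp.four_lt (z := z) (by linarith [z.norm_lt_one])
  have hw := (map_ne_zero (starRingEnd ℂ)).2
    (den_ne_zero hp.four_lt (z := w) (by linarith [w.norm_lt_one]))
  congr 1
  simp only [map_div₀, map_mul, map_pow, Complex.conj_ofReal]
  field_simp
  ring

/-- Contractivity is read off the diagonal of the kernel: `(1 - ∑ |b_j|²) / (1 - |z|²)` is the
squared norm of the kernel element at `z`. -/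
theorem schurClass_row (hp : Admissible x y c r d) {b : Fin 2 → 𝔻 → ℂ}
    (h0 : ∀ z, b 0 z = num₁ c r z / den ((x + y : ℝ) : ℂ) ((x ^ 2 + y ^ 2 : ℝ) : ℂ) z)
    (h1 : ∀ z : 𝔻, b 1 z = d * (z : ℂ) ^ 2 /
      den ((x + y : ℝ) : ℂ) ((x ^ 2 + y ^ 2 : ℝ) : ℂ) z) : SchurClass (row b) := by
  constructor
  · have hd : DifferentiableOn ℂ (fun z : ℂ =>
        (num₁ c r z / den ((x + y : ℝ) : ℂ) ((x ^ 2 + y ^ 2 : ℝ) : ℂ) z) •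
          (EuclideanSpace.proj 0 : EuclideanSpace ℂ (Fin 2) →L[ℂ] ℂ) +
        (d * z ^ 2 / den ((x + y : ℝ) : ℂ) ((x ^ 2 + y ^ 2 : ℝ) : ℂ) z) •
          (EuclideanSpace.proj 1 : EuclideanSpace ℂ (Fin 2) →L[ℂ] ℂ)) (Metric.ball 0 1) := by
      intro z hz
      have hz' : ‖z‖ < 1 := by simpa using hz
      have hne := den_ne_zero hp.four_lt (z := z) (by linarith)
      have hdd := differentiable_den ((x + y : ℝ) : ℂ) ((x ^ 2 + y ^ 2 : ℝ) : ℂ) z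
      refine DifferentiableAt.differentiableWithinAt (DifferentiableAt.add
        (DifferentiableAt.smul_const (DifferentiableAt.div ?_ hdd hne) _)
        (DifferentiableAt.smul_const (DifferentiableAt.div ?_ hdd hne) _))
      · unfold num₁; fun_prop
      · fun_prop
    refine hd.congr fun z hz => ?_
    have hz' : ‖z‖ < 1 := by simpa using hz
    have := extendZero_coe (row b) (Complex.UnitDisc.mk z hz')
    rw [Complex.UnitDisc.coe_mk] at this
    rw [this, row, Fin.sum_univ_two, h0, h1, Complex.UnitDisc.coe_mk]
  · intro z
    refine norm_row_le_one ?_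
    obtain ⟨e, -, he⟩ := exists_kernel_elements hp
    have hz := he z z
    rw [← dBRKernel_row_eq_kerFn hp h0 h1, dBRKernel_row_apply_one] at hz
    replace hz := (inner_self_eq_norm_sq_to_K (𝕜 := ℂ) (e z)).symm.trans hz
    have hz1 : 0 < 1 - ‖(z : ℂ)‖ ^ 2 := by nlinarith [norm_nonneg (z : ℂ), z.norm_lt_one]
    have e1 : 1 - conj (z : ℂ) * z = ((1 - ‖(z : ℂ)‖ ^ 2 : ℝ) : ℂ) := by
      rw [Complex.conj_mul']; push_cast; rfl
    have e2 : 1 - ∑ j, b j z * conj (b j z) = ((1 - ∑ j, ‖b j z‖ ^ 2 : ℝ) : ℂ) := by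
      simp_rw [Complex.mul_conj']; push_cast; rfl
    rw [e1, e2, ← Complex.ofReal_div] at hz
    have hz3 : ‖e z‖ ^ 2 = (1 - ∑ j, ‖b j z‖ ^ 2) / (1 - ‖(z : ℂ)‖ ^ 2) :=
      Complex.ofReal_injective (by rw [← hz, Complex.ofReal_pow]; rfl)
    have hz4 : 0 ≤ (1 - ∑ j, ‖b j z‖ ^ 2) / (1 - ‖(z : ℂ)‖ ^ 2) := hz3 ▸ sq_nonneg _
    have := (div_nonneg_iff.1 hz4)
    rcases this with h | h
    · linarith [h.1]
    · linarith [h.2]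

theorem dirichletSpace_twoPoint_eq (hp : Admissible x y c r d) {b : Fin 2 → 𝔻 → ℂ}
    (h0 : ∀ z, b 0 z = num₁ c r z / den ((x + y : ℝ) : ℂ) ((x ^ 2 + y ^ 2 : ℝ) : ℂ) z)
    (h1 : ∀ z : 𝔻, b 1 z = d * (z : ℂ) ^ 2 /
      den ((x + y : ℝ) : ℂ) ((x ^ 2 + y ^ 2 : ℝ) : ℂ) z) :
    ∃ _ : Fact (dBRKernel (row b)).PosSemidef,
      Set.range (fun h : DeBrangesRovnyak (row b) => (h : 𝔻 → ℂ)) = dirichletSpace twoPoint ∧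
        ∀ h : DeBrangesRovnyak (row b),
          dirichletNormSq twoPoint (h : 𝔻 → ℂ) = ENNReal.ofReal (‖h‖ ^ 2) := by
  obtain ⟨e, he, hk⟩ := exists_kernel_elements hp
  rw [twoPoint_eq]
  exact range_ofKernel_eq_dirichletSpace e he fun z w => by
    rw [hk, dBRKernel_row_eq_kerFn hp h0 h1]

end

end DirichletDBR

namespace DirichletDBR

/-! ### The numerical values of the parameters -/

lemma sqrt_mem_Ioo {u a b : ℝ} (ha : 0 ≤ a) (hb : 0 < b) (hau : a ^ 2 < u) (hub : u < b ^ 2) :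
    √u ∈ Set.Ioo a b :=
  ⟨(Real.lt_sqrt ha).2 hau, (Real.sqrt_lt' hb).2 hub⟩

/-- The product `m = α₁ α₂ / i` of the two poles and their normalised sum `s`. -/
lemma exists_pole_symmetric_functions : ∃ m s t : ℝ,
    s * (1 + m) = 3 * m ∧ 1 + 2 * s ^ 2 + m ^ 2 = 8 * m ∧ s ^ 2 + t ^ 2 = 2 * m ∧
      m ∈ Set.Ioo (5.46269136247035461461 : ℝ) 5.46269136247035461463 ∧ s ∈ Set.Ioo (2.5357971111816711835 : ℝ) 2.5357971111816711837 ∧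
      t ∈ Set.Ioo (2.120168798908096463 : ℝ) 2.120168798908096465 := by
  obtain ⟨a1, a2⟩ := sqrt_mem_Ioo (u := 7) (a := 2.6457513110645905905015) (b := 2.6457513110645905905017)
    (by norm_num) (by norm_num) (by norm_num) (by norm_num)
  have ha : √7 ^ 2 = (7 : ℝ) := Real.sq_sqrt (by norm_num)
  set a := √(7 : ℝ)
  obtain ⟨b1, b2⟩ := sqrt_mem_Ioo (u := 12 + 6 * a) (a := 5.279631413876118638742) (b := 5.279631413876118638744)
    (by norm_num) (by norm_num)
    (lt_trans (by norm_num : (5.279631413876118638742 : ℝ) ^ 2 < 12 + 6 * 2.6457513110645905905015) (by linarith))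
    (lt_trans (by linarith) (by norm_num : 12 + 6 * 2.6457513110645905905017 < (5.279631413876118638744 : ℝ) ^ 2))
  have hb : √(12 + 6 * a) ^ 2 = 12 + 6 * a := Real.sq_sqrt (by linarith)
  set b := √(12 + 6 * a)
  -- Eliminating `s` gives the palindromic quartic `(1 + m)² (m² - 8 m + 1) + 18 m² = 0`. In `u = m
  -- + 1 / m` it reads `u² - 6 u + 2 = 0`. Here `u = 3 + √7`, with `u² - 4 = 12 + 6 √7`, and `m` is
  -- the larger root of `m² - u m + 1 = 0`; the other root, `1 / m`, is less than 1.
  obtain ⟨m, hm⟩ : ∃ m, m = (3 + a + b) / 2 := ⟨_, rfl⟩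
  have m1 : 5.46269136247035461461 < m := by rw [hm]; linarith
  have m2 : m < 5.46269136247035461463 := by rw [hm]; linarith
  have hmm : m ^ 2 + 1 = (3 + a) * m := by rw [hm]; linear_combination (hb - ha) / 4
  have hm0 : 1 + m ≠ 0 := by linarith
  obtain ⟨s, hs⟩ : ∃ s, s = 3 * m / (1 + m) := ⟨_, rfl⟩
  have hs1 : s * (1 + m) = 3 * m := by rw [hs]; field_simp
  have hs2 : 1 + 2 * s ^ 2 + m ^ 2 = 8 * m := by
    refine mul_right_cancel₀ (pow_ne_zero 2 hm0) ?_
    linear_combination (2 * (s * (1 + m) + 3 * m)) * hs1 + (m ^ 2 - 6 * m + 1 + (3 + a) * m) * hmm +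
      m ^ 2 * ha
  have s1 : 2.5357971111816711835 < s := by rw [hs, lt_div_iff₀ (by linarith)]; linarith
  have s2 : s < 2.5357971111816711837 := by rw [hs, div_lt_iff₀ (by linarith)]; linarith
  -- Equivalent to `s² = (5 - √7) m / 2`; this form gives sharp bounds for `t` as a product of
  -- positive increasing factors.
  have e : 2 * m - s ^ 2 = m * (a - 1) / 2 := by linear_combination (-1 / 2) * hs2 + hmm / 2
  have t1 : (2.120168798908096463 : ℝ) ^ 2 < 2 * m - s ^ 2 := by
    rw [e]
    have : (5.46269136247035461461 : ℝ) * (2.6457513110645905905015 - 1) < m * (a - 1) := by gcongr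
    refine lt_trans ?_ (div_lt_div_of_pos_right this two_pos)
    norm_num
  have t2 : 2 * m - s ^ 2 < (2.120168798908096465 : ℝ) ^ 2 := by
    rw [e]
    have : m * (a - 1) < (5.46269136247035461463 : ℝ) * (2.6457513110645905905017 - 1) := by gcongr; linarith
    refine lt_trans (div_lt_div_of_pos_right this two_pos) ?_
    norm_num
  refine ⟨m, s, √(2 * m - s ^ 2), hs1, hs2, ?_, ⟨m1, m2⟩, ⟨s1, s2⟩,
    sqrt_mem_Ioo (by norm_num) (by norm_num) t1 t2⟩
  rw [Real.sq_sqrt (le_trans (by norm_num) t1.le)]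
  ring

lemma exists_admissible : ∃ x y c r d : ℝ,
    |x - 2.32798295504488| ≤ 5 / 10 ^ 15 ∧
    |y - 0.207814156136787| ≤ 5 / 10 ^ 16 ∧
    |c - 4.13925355| ≤ 5 / 10 ^ 9 ∧
    |r - 1.31972862| ≤ 5 / 10 ^ 9 ∧
    |d - 1.11084575| ≤ 5 / 10 ^ 9 ∧ Admissible x y c r d := by
  obtain ⟨m, s, t, hs1, hs2, hst, ⟨m1, m2⟩, ⟨s1, s2⟩, ⟨t1, t2⟩⟩ := exists_pole_symmetric_functions
  have hD : 0 < m - s + 1 := by linarith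
  -- `C` is the value of `c²` forced by the relation `lead`; then `cross` gives `r` and `mass` gives
  -- `d`.
  obtain ⟨C, hC⟩ : ∃ C, C = m * (3 * m - 2 * s + 1) / (m - s + 1) := ⟨_, rfl⟩
  have hC' : C * (m - s + 1) = m * (3 * m - 2 * s + 1) := by rw [hC]; field_simp
  have C1 : 17.133419916453485 < C := by
    rw [hC, lt_div_iff₀ hD]
    have : (5.46269136247035461461 : ℝ) * (3 * 5.46269136247035461461 - 2 * 2.5357971111816711837 + 1) < m * (3 * m - 2 * s + 1) := by
      gcongr
    linarith
  have C2 : C < 17.133419916453487 := by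
    rw [hC, div_lt_iff₀ hD]
    have : m * (3 * m - 2 * s + 1) < (5.46269136247035461463 : ℝ) * (3 * 5.46269136247035461463 - 2 * 2.5357971111816711835 + 1) := by
      gcongr; linarith
    linarith
  obtain ⟨c1, c2⟩ := sqrt_mem_Ioo (u := C) (a := 4.13925354580429) (b := 4.13925354580431)
    (by norm_num) (by norm_num) (lt_trans (by norm_num) C1) (lt_trans C2 (by norm_num))
  have hc : √C ^ 2 = C := Real.sq_sqrt (by linarith)
  set c := √C
  have hc0 : 0 < c := by linarith
  obtain ⟨r, hr⟩ : ∃ r, r = m / c := ⟨_, rfl⟩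
  have hr' : c * r = m := by rw [hr]; field_simp
  have r1 : 1.3197286182208 < r := by rw [hr, lt_div_iff₀ hc0]; linarith
  have r2 : r < 1.3197286182210 := by rw [hr, div_lt_iff₀ hc0]; linarith
  have rr1 : (1.3197286182208 : ℝ) ^ 2 < r ^ 2 := by gcongr
  have rr2 : r ^ 2 < (1.3197286182210 : ℝ) ^ 2 := by gcongr
  have d1 : (1.11084575072 : ℝ) ^ 2 < 4 * m - C - 2 * r ^ 2 := by linarith
  have d2 : 4 * m - C - 2 * r ^ 2 < (1.11084575074 : ℝ) ^ 2 := by linarith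
  obtain ⟨e1, e2⟩ := sqrt_mem_Ioo (by norm_num) (by norm_num) d1 d2
  have hd : √(4 * m - C - 2 * r ^ 2) ^ 2 = 4 * m - C - 2 * r ^ 2 :=
    Real.sq_sqrt (le_trans (by norm_num) d1.le)
  set d := √(4 * m - C - 2 * r ^ 2)
  -- `t` plays the role of `x - y`, since `(x + y)² + (x - y)² = 2 (x² + y²)`.
  have hsum : (s + t) / 2 + (s - t) / 2 = s := by ring
  have hnorm : ((s + t) / 2) ^ 2 + ((s - t) / 2) ^ 2 = m := by linear_combination hst / 2
  refine ⟨(s + t) / 2, (s - t) / 2, c, r, d, ?_, ?_, ?_, ?_, ?_, ⟨?_, ?_, ?_, ?_, ?_, ?_⟩⟩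
  · rw [abs_le]; constructor <;> linarith
  · rw [abs_le]; constructor <;> linarith
  · rw [abs_le]; constructor <;> linarith
  · rw [abs_le]; constructor <;> linarith
  · rw [abs_le]; constructor <;> linarith
  · rw [hsum, hnorm, hs1]
  · rw [hsum, hnorm, hs2]
  · rw [hnorm, hr']
  · rw [hnorm, hc, hd]; ring
  · rw [hsum, hnorm, hc, hC']
  · rw [hnorm]; linarith

end DirichletDBR

/-! ### The explicit representation of the two-point space. -/

theorem theorem2p4 :
    ∃ x y c r d : ℝ,
      |x - 2.32798295504488| ≤ 5 / 10 ^ 15 ∧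
      |y - 0.207814156136787| ≤ 5 / 10 ^ 16 ∧
      |c - 4.13925355| ≤ 5 / 10 ^ 9 ∧
      |r - 1.31972862| ≤ 5 / 10 ^ 9 ∧
      |d - 1.11084575| ≤ 5 / 10 ^ 9 ∧
      ∃ (α₁ α₂ : ℂ) (q p₁ p₂ : Polynomial ℂ) (B : 𝔻 → (EuclideanSpace ℂ (Fin 2) →L[ℂ] ℂ)),
        α₁ = (x : ℂ) + Complex.I * (y : ℂ) ∧
        α₂ = (y : ℂ) + Complex.I * (x : ℂ) ∧
        q = (Polynomial.X - Polynomial.C α₁) * (Polynomial.X - Polynomial.C α₂) ∧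
        p₁ = Polynomial.C (c : ℂ) * Polynomial.X +
          Polynomial.C (-(r : ℂ) + (r : ℂ) * Complex.I) * Polynomial.X ^ 2 ∧
        p₂ = Polynomial.C (d : ℂ) * Polynomial.X ^ 2 ∧
        B = DirichletDBR.row
          ![fun z => p₁.eval (z : ℂ) / q.eval (z : ℂ), fun z => p₂.eval (z : ℂ) / q.eval (z : ℂ)] ∧
        (∀ z : 𝔻, q.eval (z : ℂ) ≠ 0) ∧
        DirichletDBR.SchurClass B ∧
        ∃ _ : Fact (DirichletDBR.dBRKernel B).PosSemidef,
          Set.range (fun h : DirichletDBR.DeBrangesRovnyak B => (h : 𝔻 → ℂ)) =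
              DirichletDBR.dirichletSpace DirichletDBR.twoPoint ∧
          ∀ h : DirichletDBR.DeBrangesRovnyak B,
            DirichletDBR.dirichletNormSq DirichletDBR.twoPoint (h : 𝔻 → ℂ) =
              ENNReal.ofReal (‖h‖ ^ 2) := by
  obtain ⟨x, y, c, r, d, hx, hy, hc, hr, hd, hp⟩ := DirichletDBR.exists_admissible
  refine ⟨x, y, c, r, d, hx, hy, hc, hr, hd, _, _, _, _, _, _, rfl, rfl, rfl, rfl, rfl, rfl, ?_⟩
  have hq : ∀ z : 𝔻, ((Polynomial.X - Polynomial.C ((x : ℂ) + Complex.I * y)) *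
      (Polynomial.X - Polynomial.C ((y : ℂ) + Complex.I * x))).eval (z : ℂ) =
      DirichletDBR.den ((x + y : ℝ) : ℂ) ((x ^ 2 + y ^ 2 : ℝ) : ℂ) z := fun z => by
    rw [DirichletDBR.den_eq_mul]
    simp
  have hb : ∀ z : 𝔻, (Polynomial.C (c : ℂ) * Polynomial.X +
      Polynomial.C (-(r : ℂ) + (r : ℂ) * Complex.I) * Polynomial.X ^ 2).eval (z : ℂ) =
      DirichletDBR.num₁ c r z := fun z => by
    rw [DirichletDBR.num₁]
    simp
  refine ⟨fun z => ?_, DirichletDBR.schurClass_row hp (fun z => ?_) fun z => ?_,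
    DirichletDBR.dirichletSpace_twoPoint_eq hp (fun z => ?_) fun z => ?_⟩
  · rw [hq]
    exact DirichletDBR.den_ne_zero hp.four_lt (by linarith [z.norm_lt_one])
  · simp only [Matrix.cons_val_zero, hq, hb]
  · simp only [Matrix.cons_val_one, Matrix.cons_val_zero, hq, Polynomial.eval_mul, Polynomial.eval_C,
      Polynomial.eval_pow, Polynomial.eval_X]
  · simp only [Matrix.cons_val_zero, hq, hb]
  · simp only [Matrix.cons_val_one, Matrix.cons_val_zero, hq, Polynomial.eval_mul, Polynomial.eval_C,
      Polynomial.eval_pow, Polynomial.eval_X]
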